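/- **Setting.** Fix integers $T\ge 1$ and $d_z,d_x,d_a\ge 0$, a noise level $\sigma^2\ge 0$, and a non-empty set $\mathcal A\subseteq\mathbb R^{d_a}$ (the possible values of the continuous auxiliary variable). A model is $\theta=(f,p,G)$, where $f:\mathbb R^{d_z}\to\mathbb R^{d_x}$ is a decoder, $p(z^t\mid z^{<t},a^{<t})$, $t\in\{1,\dots,T\}$, is a transition density, with $z^{<t}=(z^1,\dots,z^{t-1})\in\mathbb R^{d_z\times(t-1)}$ and $a^{<t}=(a^0,\dots,a^{t-1})\in\mathcal A^t$, and $G=[G^z,G^a]$ with $G^z\in\{0,1\}^{d_z\times d_z}$, $G^a\in\{0,1\}^{d_z\times d_a}$. "$C^k$ on $S$", for an arbitrary set $S$, means having a $C^k$ extension to an open neighbourhood of $S$; a diffeomorphism is a $C^1$ bijection with $C^1$ inverse. Consider the following assumptions. 1. (Observation model) $x^t=f(z^t)+n^t$ for all $t$, where the $n^t\sim\mathcal N(0,\sigma^2 I)$ are independent across time and independent of the $z^t$ and $a^t$; $d_z\le d_x$; $f$ is a diffeomorphism onto its image, and $f(\mathbb R^{d_z})$ is closed. 2. (Conditional independence)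 For all $t$, $z^{<t}$ and $a^{<t}\in\mathcal A^t$, $p(\cdot\mid z^{<t},a^{<t})$ is a probability density with respect to Lebesgue measure on $\mathbb R^{d_z}$, $p(z^t\mid z^{<t},a^{<t})=\prod_{i} p(z^t_i\mid z^{<t},a^{<t})$ with $p(z_i^t\mid\cdot)$ its $i$-th marginal density, and each of these marginal distributions has topological support $\mathbb R$. 3. (Markov graph) For each $i$, $p(z_i^t\mid z^{<t},a^{<t})$ depends on $z^{<t}$ only through the coordinates $j$ with $G^z_{i,j}=1$ and on $a^{<t}\in\mathcal A^t$ only through the coordinates $\ell$ with $G^a_{i,\ell}=1$. 4. (Smoothness) $\mathcal A=\overline{\mathcal A^\circ}$, and each $p(z_i^t\mid z^{<t},a^{<t})$ is $C^2$ on $\mathbb R\times\mathbb R^{d_z\times(t-1)}\times\mathcal A^t$. Let $\theta=(f,p,G)$ and $\hat\theta=(\hat f,\hat p,\hat G)$ be two models satisfying 1–4 with the same $T,d_z,d_x,d_a,\sigma^2,\mathcal A$. Assume: * (Observational equivalence) for every $a^{<T}\in\mathcal A^T$, the conditional distributions of $x^{\le T}$ given $a^{<T}$ under $\theta$ and $\hat\theta$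 coincide; * (Sufficient influence of $a$) let $H^{t,\tau}_{z,a}\log p\in\mathbb R^{d_z\times d_a}$ be the matrix with entries $\frac{\partial^2}{\partial a^\tau_\ell\,\partial z^t_i}\log p(z^t\mid z^{<t},a^{<t})$ (at boundary points of $\mathcal A^t$ derivatives are those of any $C^2$ extension), and let $\mathbf{Ch}_\ell=\{i: G^a_{i,\ell}=1\}$. For Lebesgue-almost every $z\in\mathbb R^{d_z}$ and every $\ell\in\{1,\dots,d_a\}$ there are $(t_{(r)},\tau_{(r)},z_{(r)},a_{(r)})$, $1\le r\le|\mathbf{Ch}_\ell|$, with $1\le t_{(r)}\le T$, $0\le\tau_{(r)}<t_{(r)}$, $z_{(r)}\in\mathbb R^{d_z\times(t_{(r)}-1)}$, $a_{(r)}\in\mathcal A^{t_{(r)}}$ and $p(z\mid z_{(r)},a_{(r)})>0$ (so that $\log p$ is defined), such that $$\operatorname{span}\Big\{\big(H^{t_{(r)},\tau_{(r)}}_{z,a}\log p(z\mid z_{(r)},a_{(r)})\big)_{\cdot,\ell}\Big\}_{r=1}^{|\mathbf{Ch}_\ell|}=\{x\in\mathbb R^{d_z}: x_i=0\text{ for all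 } i\notin\mathbf{Ch}_\ell\}.$$ **Conclusion.** There is a permutation matrix $P$ such that $PG^a\subseteq\hat G^a$ (inclusion of the sets of nonzero entries). If in addition $\|\hat G^a\|_0\le\|G^a\|_0$ (numbers of nonzero entries), then $\theta$ and $\hat\theta$ are $a$-consistent. That is, there is a permutation matrix $P$ such that * $f(\mathbb R^{d_z})=\hat f(\mathbb R^{d_z})$, the map $v:=f^{-1}\circ\hat f$ is a diffeomorphism of $\mathbb R^{d_z}$, and $\hat p(z^t\mid z^{<t},a^{<t})=p(v(z^t)\mid v(z^{<t}),a^{<t})\,|\det Dv(z^t)|$ for all $t$, all $a^{<t}\in\mathcal A^t$ and all $z^{\le t}$, where $v$ acts on $z^{<t}$ columnwise; * $\hat G^a=PG^a$; * $v=c\circ P^\top$ for some $G^a$-preserving diffeomorphism $c$ of $\mathbb R^{d_z}$. Here $c$ is $G^a$-preserving if its dependency graph $C\in\{0,1\}^{d_z\times d_z}$ ($C_{i,j}=0$ iff $c_i$ is a function of the coordinates other than the $j$-th) satisfies $C^\top M\in\mathbb R^{d_z\times d_a}_{G^a}$ for every $M\in\mathbb R^{d_z\times d_a}_{G^a}:=\{M\in\mathbb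 R^{d_z\times d_a}: G^a_{i,\ell}=0\Rightarrow M_{i,\ell}=0\}$. -/

import Mathlib

open MeasureTheory ProbabilityTheory
open scoped Matrix NNReal ENNReal

namespace Disentangle

noncomputable section

/-! ### Maps of class `C^k` on arbitrary sets, diffeomorphisms -/

/-- `g` is a `C^k` extension of `h` from the set `S` to some open neighbourhood of `S`. -/
def IsCkExtension {E F : Type*} [NormedAddCommGroup E] [NormedSpace ℝ E]
    [NormedAddCommGroup F] [NormedSpace ℝ F]
    (k : WithTop ℕ∞) (S : Set E) (h g : E → F) : Prop :=
  ∃ U : Set E, IsOpen U ∧ S ⊆ U ∧ ContDiffOn ℝ k g U ∧ Set.EqOn g h S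

/-- `h` is of class `C^k` on the arbitrary set `S`: it has a `C^k` extension to an open
neighbourhood of `S`. -/
def CkOn {E F : Type*} [NormedAddCommGroup E] [NormedSpace ℝ E]
    [NormedAddCommGroup F] [NormedSpace ℝ F]
    (k : WithTop ℕ∞) (S : Set E) (h : E → F) : Prop :=
  ∃ g : E → F, IsCkExtension k S h g

open Classical in
/-- Some `C^k` extension of `h` from `S` (and `h` itself when there is none). If `S` is contained
in the closure of its interior, the derivatives up to order `k` at points of `S` do not depend on
the extension. -/
def ckExtension {E F : Type*} [NormedAddCommGroup E] [NormedSpace ℝ E]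
    [NormedAddCommGroup F] [NormedSpace ℝ F]
    (k : WithTop ℕ∞) (S : Set E) (h : E → F) : E → F :=
  if H : CkOn k S h then H.choose else h

/-- `f : ℝᵐ → ℝⁿ` is a diffeomorphism onto its image: a `C^1` injection whose inverse
`f(ℝᵐ) → ℝᵐ` is `C^1`. -/
def IsDiffeoOntoImage {m n : ℕ} (f : (Fin m → ℝ) → (Fin n → ℝ)) : Prop :=
  Function.Injective f ∧ ContDiff ℝ 1 f ∧ CkOn 1 (Set.range f) (Function.invFun f)

/-- `c` is a `C^1` diffeomorphism from `ℝᵐ` to itself. -/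
def IsDiffeo {m : ℕ} (c : (Fin m → ℝ) → (Fin m → ℝ)) : Prop :=
  Function.Bijective c ∧ ContDiff ℝ 1 c ∧ ContDiff ℝ 1 (Function.invFun c)

/-! ### Binary matrices, aligned subspaces, dependency graphs -/

/-- The `{0,1}`-valued real matrix of a binary matrix. -/
def adj {m n : ℕ} (G : Matrix (Fin m) (Fin n) Bool) : Matrix (Fin m) (Fin n) ℝ :=
  Matrix.of fun i j => if G i j = true then 1 else 0

/-- `A ⊆ B` for matrices seen as index sets, that is, inclusion of the sets of nonzero entries. -/
def SuppSubset {m n : ℕ} (A B : Matrix (Fin m) (Fin n) ℝ) : Prop :=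
  ∀ i j, A i j ≠ 0 → B i j ≠ 0

/-- `‖G‖₀`, the number of nonzero entries. -/
def nnz {m n : ℕ} (G : Matrix (Fin m) (Fin n) Bool) : ℕ :=
  (Finset.univ.filter fun ij : Fin m × Fin n => G ij.1 ij.2 = true).card

/-- The set of children of the column index `l`. -/
def children {m n : ℕ} (G : Matrix (Fin m) (Fin n) Bool) (l : Fin n) : Finset (Fin m) :=
  Finset.univ.filter fun i => G i l = true

/-- The aligned subspace `ℝᵐ_B` of the vectors that vanish outside `B`. -/
def alignedVectors {m : ℕ} (B : Finset (Fin m)) : Submodule ℝ (Fin m → ℝ) where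
  carrier := {x | ∀ i, i ∉ B → x i = 0}
  add_mem' := by
    intro x y hx hy i hi
    simp [hx i hi, hy i hi]
  zero_mem' := by
    intro i _
    rfl
  smul_mem' := by
    intro r x hx i hi
    simp [hx i hi]

/-- The aligned subspace `ℝ^{m × n}_G` of the matrices that vanish outside `G`. -/
def alignedMatrices {m n : ℕ} (G : Matrix (Fin m) (Fin n) Bool) :
    Set (Matrix (Fin m) (Fin n) ℝ) :=
  {M | ∀ i j, G i j = false → M i j = 0}

/-- `C` is a `G`-preserving matrix: `Cᵀ ℝ^{m × n}_G ⊆ ℝ^{m × n}_G`. -/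
def PreservingMatrix {m n : ℕ} (G : Matrix (Fin m) (Fin n) Bool)
    (C : Matrix (Fin m) (Fin m) ℝ) : Prop :=
  ∀ M ∈ alignedMatrices G, Cᵀ * M ∈ alignedMatrices G

open Classical in
/-- The dependency graph of `h : ℝⁿ → ℝᵐ`: the entry `(i, j)` is `0` iff `h_i` is a function of
the coordinates other than the `j`-th. -/
def depGraph {n m : ℕ} (h : (Fin n → ℝ) → (Fin m → ℝ)) : Matrix (Fin m) (Fin n) Bool :=
  Matrix.of fun i j =>
    decide (¬ ∃ hbar : ({k : Fin n // k ≠ j} → ℝ) → ℝ,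
      ∀ a : Fin n → ℝ, h a i = hbar (fun k => a k))

/-- `c : ℝᵐ → ℝᵐ` is a `G`-preserving function: its dependency graph is `G`-preserving. -/
def PreservingMap {m n : ℕ} (G : Matrix (Fin m) (Fin n) Bool)
    (c : (Fin m → ℝ) → (Fin m → ℝ)) : Prop :=
  PreservingMatrix G (adj (depGraph c))

/-! ### Latent variable models

The time steps `1, …, T` are indexed by `t : Fin T` counted from `0`. Thus the latent history
of step `t` has `t` entries, and its auxiliary history (whose first entry is the auxiliary vector
of time `0`) has `t + 1` entries. -/

/-- Parameters `(f, p, G)` of a latent variable model with horizon `T`: the decoder `f`, the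
transition density `p(zᵗ ∣ z^{<t}, a^{<t})`, and the graph `G = [Gᶻ, Gᵃ]`. -/
structure LatentModel (T dz dx da : ℕ) where
  /-- the decoder -/
  f : (Fin dz → ℝ) → (Fin dx → ℝ)
  /-- the transition density, `p t zᵗ z^{<t} a^{<t}` -/
  p : (t : Fin T) → (Fin dz → ℝ) → (Fin (t : ℕ) → Fin dz → ℝ) →
    (Fin ((t : ℕ) + 1) → Fin da → ℝ) → ℝ
  /-- the graph from past latent factors to latent factors -/
  Gz : Matrix (Fin dz) (Fin dz) Bool
  /-- the graph from auxiliary variables to latent factors -/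
  Ga : Matrix (Fin dz) (Fin da) Bool

variable {T dz dx da : ℕ}

/-- `𝒜ᵏ`: sequences of length `k` of vectors of `𝒜`. -/
def seqs (A : Set (Fin da → ℝ)) (k : ℕ) : Set (Fin k → Fin da → ℝ) :=
  {a | ∀ s, a s ∈ A}

/-- The latent history before step `t`. -/
def zPast (z : Fin T → Fin dz → ℝ) (t : Fin T) : Fin (t : ℕ) → Fin dz → ℝ :=
  fun s => z (Fin.castLE t.isLt.le s)

/-- The auxiliary history before step `t`. -/
def aPast (a : Fin T → Fin da → ℝ) (t : Fin T) : Fin ((t : ℕ) + 1) → Fin da → ℝ :=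
  fun s => a (Fin.castLE t.isLt s)

namespace LatentModel

/-- The mechanism `p(zᵢᵗ ∣ z^{<t}, a^{<t})`: the `i`-th marginal of the transition density. -/
def mech (θ : LatentModel T dz dx da) (t : Fin T) (i : Fin dz) (s : ℝ)
    (zh : Fin (t : ℕ) → Fin dz → ℝ) (ah : Fin ((t : ℕ) + 1) → Fin da → ℝ) : ℝ :=
  ∫ w : {j : Fin dz // j ≠ i} → ℝ, θ.p t (fun j => if h : j = i then s else w ⟨j, h⟩) zh ah

/-- The decoder part of the observation model: `f` is a diffeomorphism onto its closed image.
The additive Gaussian noise enters through `obsLaw`. -/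
def ObservationModel (θ : LatentModel T dz dx da) : Prop :=
  dz ≤ dx ∧ IsDiffeoOntoImage θ.f ∧ IsClosed (Set.range θ.f)

/-- Conditionally independent latent factors: `p(zᵗ ∣ z^{<t}, a^{<t})` is a probability density
with respect to Lebesgue measure, is the product of its mechanisms, and every mechanism has
support `ℝ` (the topological support of the distribution with that density). -/
def CondIndep (A : Set (Fin da → ℝ)) (θ : LatentModel T dz dx da) : Prop :=
  ∀ (t : Fin T) (zh : Fin (t : ℕ) → Fin dz → ℝ), ∀ ah ∈ seqs A ((t : ℕ) + 1),
    (Measurable fun z => θ.p t z zh ah) ∧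
    (∀ z, 0 ≤ θ.p t z zh ah) ∧
    (∫⁻ z, ENNReal.ofReal (θ.p t z zh ah)) = 1 ∧
    (∀ z, θ.p t z zh ah = ∏ i, θ.mech t i (z i) zh ah) ∧
    (∀ i, ((volume : Measure ℝ).withDensity
      fun s => ENNReal.ofReal (θ.mech t i s zh ah)).support = Set.univ)

/-- The transition model is Markov with respect to `G`: the mechanism `i` depends on the history
only through the coordinates that are parents of `i`. -/
def MarkovGraph (A : Set (Fin da → ℝ)) (θ : LatentModel T dz dx da) : Prop :=
  ∀ (t : Fin T) (i : Fin dz) (s : ℝ) (zh zh' : Fin (t : ℕ) → Fin dz → ℝ),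
    ∀ ah ∈ seqs A ((t : ℕ) + 1), ∀ ah' ∈ seqs A ((t : ℕ) + 1),
      (∀ r j, θ.Gz i j = true → zh r j = zh' r j) →
      (∀ r l, θ.Ga i l = true → ah r l = ah' r l) →
      θ.mech t i s zh ah = θ.mech t i s zh' ah'

/-- Smoothness of the mechanisms (continuous auxiliary variable): they are `C²` on
`ℝ × ℝ^{dz × (t-1)} × 𝒜ᵗ`, and `𝒜` is regular closed. -/
def SmoothTransition (A : Set (Fin da → ℝ)) (θ : LatentModel T dz dx da) : Prop :=
  closure (interior A) = A ∧
  ∀ (t : Fin T) (i : Fin dz),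
    CkOn 2 (Set.univ ×ˢ (Set.univ ×ˢ seqs A ((t : ℕ) + 1)))
      (fun y : ℝ × (Fin (t : ℕ) → Fin dz → ℝ) × (Fin ((t : ℕ) + 1) → Fin da → ℝ) =>
        θ.mech t i y.1 y.2.1 y.2.2)

/-- The conditional distribution of `z^{≤T}` given `a^{<T}`. -/
def latentLaw (θ : LatentModel T dz dx da) (a : Fin T → Fin da → ℝ) :
    Measure (Fin T → Fin dz → ℝ) :=
  volume.withDensity fun z => ∏ t, ENNReal.ofReal (θ.p t (z t) (zPast z t) (aPast a t))

/-- The distribution of the noise: independent centred Gaussian coordinates of variance `σ²`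
(a Dirac mass at `0` when `σ² = 0`). -/
def noiseLaw (T dx : ℕ) (σ2 : ℝ≥0) : Measure (Fin T → Fin dx → ℝ) :=
  Measure.pi fun _ => Measure.pi fun _ => gaussianReal 0 σ2

/-- The conditional distribution of `x^{≤T}` given `a^{<T}`, where `xᵗ = f(zᵗ) + nᵗ` and the
noise is independent of the latent variables. -/
def obsLaw (σ2 : ℝ≥0) (θ : LatentModel T dz dx da) (a : Fin T → Fin da → ℝ) :
    Measure (Fin T → Fin dx → ℝ) :=
  ((θ.latentLaw a).prod (noiseLaw T dx σ2)).map fun zn t => θ.f (zn.1 t) + zn.2 t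

/-- Observational equivalence: the same distribution of observations for all `a^{<T} ∈ 𝒜ᵀ`. -/
def ObsEquiv (σ2 : ℝ≥0) (A : Set (Fin da → ℝ)) (θ θ' : LatentModel T dz dx da) : Prop :=
  ∀ a ∈ seqs A T, θ.obsLaw σ2 a = θ'.obsLaw σ2 a

/-- The entanglement map `v = f⁻¹ ∘ f'`. -/
def entanglement (θ θ' : LatentModel T dz dx da) : (Fin dz → ℝ) → (Fin dz → ℝ) :=
  Function.invFun θ.f ∘ θ'.f

/-- Equivalence up to diffeomorphism. -/
def DiffEquiv (A : Set (Fin da → ℝ)) (θ θ' : LatentModel T dz dx da) : Prop :=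
  Set.range θ.f = Set.range θ'.f ∧
  IsDiffeo (entanglement θ θ') ∧
  ∀ (t : Fin T), ∀ ah ∈ seqs A ((t : ℕ) + 1), ∀ (zh : Fin (t : ℕ) → Fin dz → ℝ)
    (z : Fin dz → ℝ),
    θ'.p t z zh ah =
      θ.p t (entanglement θ θ' z) (fun s => entanglement θ θ' (zh s)) ah *
        |(fderiv ℝ (entanglement θ θ') z).det|

/-- `a`-consistency: for some permutation matrix `P`, the models are equivalent up to
diffeomorphism, `G'ᵃ = P Gᵃ`, and `v = c ∘ Pᵀ` with `c` a `Gᵃ`-preserving diffeomorphism. -/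
def AConsistent (A : Set (Fin da → ℝ)) (θ θ' : LatentModel T dz dx da) : Prop :=
  ∃ π : Equiv.Perm (Fin dz),
    DiffEquiv A θ θ' ∧
    adj θ'.Ga = π.permMatrix ℝ * adj θ.Ga ∧
    ∃ c : (Fin dz → ℝ) → (Fin dz → ℝ),
      IsDiffeo c ∧ PreservingMap θ.Ga c ∧
      ∀ z, entanglement θ θ' z = c ((π.permMatrix ℝ)ᵀ *ᵥ z)

/-- The logarithm of (a `C²` extension from `ℝ^{dz} × ℝ^{dz × (t-1)} × 𝒜ᵗ` of) the transition
density, as a function of `(zᵗ, z^{<t}, a^{<t})`. -/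
def logDensity (A : Set (Fin da → ℝ)) (θ : LatentModel T dz dx da) (t : Fin T) :
    (Fin dz → ℝ) × (Fin (t : ℕ) → Fin dz → ℝ) × (Fin ((t : ℕ) + 1) → Fin da → ℝ) → ℝ :=
  fun y => Real.log
    (ckExtension 2 (Set.univ ×ˢ (Set.univ ×ˢ seqs A ((t : ℕ) + 1)))
      (fun x : (Fin dz → ℝ) × (Fin (t : ℕ) → Fin dz → ℝ) ×
          (Fin ((t : ℕ) + 1) → Fin da → ℝ) => θ.p t x.1 x.2.1 x.2.2) y)

/-- The cross Hessian `H^{t,τ}_{z,a} log p (z ∣ z^{<t}, a^{<t})`: its entry `(i, l)` is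
`∂²/∂a_l^τ ∂z_i^t log p`. -/
def crossHessian (A : Set (Fin da → ℝ)) (θ : LatentModel T dz dx da) (t : Fin T)
    (τ : Fin ((t : ℕ) + 1)) (z : Fin dz → ℝ) (zh : Fin (t : ℕ) → Fin dz → ℝ)
    (ah : Fin ((t : ℕ) + 1) → Fin da → ℝ) : Matrix (Fin dz) (Fin da) ℝ :=
  Matrix.of fun i l =>
    fderiv ℝ (fun y => fderiv ℝ (θ.logDensity A t) y (Pi.single i 1, 0, 0)) (z, zh, ah)
      (0, 0, Pi.single τ (Pi.single l 1))

end LatentModel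

/-- A tuple `(t, τ, z^{<t}, a^{<t})` with `τ < t`. -/
structure HistoryPoint (T dz da : ℕ) where
  /-- the time step -/
  t : Fin T
  /-- the time of the auxiliary vector with respect to which one differentiates -/
  τ : Fin ((t : ℕ) + 1)
  /-- the latent history -/
  zh : Fin (t : ℕ) → Fin dz → ℝ
  /-- the auxiliary history -/
  ah : Fin ((t : ℕ) + 1) → Fin da → ℝ

/-- Sufficient influence of the continuous auxiliary variable. The points are taken where the
density is positive, so that `log p` is defined (and `C²`) there. -/
def LatentModel.SufficientInfluence (A : Set (Fin da → ℝ)) (θ : LatentModel T dz dx da) : Prop :=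
  ∀ᵐ z : Fin dz → ℝ, ∀ l : Fin da,
    ∃ γ : Fin (children θ.Ga l).card → HistoryPoint T dz da,
      (∀ r, (γ r).ah ∈ seqs A (((γ r).t : ℕ) + 1)) ∧
      (∀ r, 0 < θ.p (γ r).t z (γ r).zh (γ r).ah) ∧
      Submodule.span ℝ (Set.range fun r => fun i =>
        θ.crossHessian A (γ r).t (γ r).τ z (γ r).zh (γ r).ah i l) =
        alignedVectors (children θ.Ga l)

end

end Disentangle

/-!
The two models are first shown to be equivalent up to the diffeomorphism `v = f⁻¹ ∘ f'`, and the
Jacobian of `v` is then shown to vanish wherever the two graphs forbid an interaction.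

*Equivalence up to diffeomorphism* (`LatentModel.ObsEquiv.diffEquiv`). The characteristic function
of the Gaussian noise has no zero, so that the noise can be removed from the laws of the
observations (`eq_of_conv_eq`). The mechanisms have full support, hence so does the latent law; as
the images of the decoders are closed, they coincide. The change of variables by `v` in each time
step gives two factorizations of the same continuous joint density. Integrating out the time
steps from the last one downwards shows that the initial products of the factors agree, and
dividing by these products, which are nonzero on a dense set, shows that the single factors agree
(`causal_factors_eq`), that is,
`p'(zᵗ ∣ z^{<t}, a^{<t}) = p(v(zᵗ) ∣ v(z^{<t}), a^{<t}) |det Dv(zᵗ)|`.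

*Support of the Jacobian* (`LatentModel.DiffEquiv.fderiv_entanglement_eq_zero`). If `a_l` does not
act on the factor `i` of the second model, then `log p'` is locally a function of `z_i` plus a
function of `a_l`, and so is `log p(v(z) ∣ v(z^{<t}), a^{<t})`, the Jacobian being independent of
`a`. Since `v` is only `C¹`, one differentiates along `a_l` first, and along `z_i` afterwards: the
cross Hessian column of `log p` at `v(z)` is orthogonal to the column `i` of `Dv(z)`. By continuity
this extends from the interior of `𝒜ᵗ` to `𝒜ᵗ`. Sufficient influence says that these Hessian columns
span the coordinate subspace of the children of `a_l`, whence `∂v_j/∂z_i = 0` for every child `j`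
of `a_l`, for almost every `z`, and then for all `z` by continuity.

*Permutation.* As `Dv(0)` is invertible, there is a permutation `π` with `∂v_{π(i)}/∂z_i ≠ 0` at `0`
for all `i`, and the edges of `G^a` permuted by `π` are edges of `G'^a`. If `G'^a` has no more edges
than `G^a`, the two sets of edges coincide, and the vanishing partial derivatives of `c = v ∘ P` say
that `c_j` does not depend on `y_k` unless the row `j` of `G^a` is contained in the row `k`,
which is what makes `c` preserve `G^a`.
-/

namespace Disentangle

open Function Filter Topology

/-! ### Joint densities factored along time -/

section Causal

variable {T : ℕ} {E : Type*}

/-- A family of factors `q t`, functions of a whole trajectory, is causal if `q t` depends only on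
the trajectory up to and including time `t`. -/
def IsCausal (q : Fin T → (Fin T → E) → ℝ≥0∞) : Prop :=
  ∀ t z z', (∀ s ≤ t, z s = z' s) → q t z = q t z'

/-- A family of factors is normalized if each `q t` is a probability density in the coordinate of
time `t`, the other coordinates being fixed. -/
def IsNormalized [MeasureSpace E] (q : Fin T → (Fin T → E) → ℝ≥0∞) : Prop :=
  ∀ t z, ∫⁻ w, q t (update z t w) = 1

/-- The product of the factors of the first `k` time steps. -/
noncomputable def initialProd (q : Fin T → (Fin T → E) → ℝ≥0∞) (k : ℕ) (z : Fin T → E) : ℝ≥0∞ :=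
  ∏ t ∈ Finset.univ.filter (fun t : Fin T => (t : ℕ) < k), q t z

lemma filter_lt_succ_eq_insert (k : Fin T) :
    Finset.univ.filter (fun t : Fin T => (t : ℕ) < (k : ℕ) + 1) =
      insert k (Finset.univ.filter (fun t : Fin T => (t : ℕ) < (k : ℕ))) := by
  ext t
  simp only [Finset.mem_filter, Finset.mem_univ, true_and, Finset.mem_insert, Fin.ext_iff]
  omega

lemma initialProd_zero (q : Fin T → (Fin T → E) → ℝ≥0∞) (z : Fin T → E) :
    initialProd q 0 z = 1 := by
  simp [initialProd]

lemma initialProd_succ (q : Fin T → (Fin T → E) → ℝ≥0∞) (k : Fin T) (z : Fin T → E) :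
    initialProd q ((k : ℕ) + 1) z = initialProd q k z * q k z := by
  rw [initialProd, filter_lt_succ_eq_insert, Finset.prod_insert (by simp), mul_comm, initialProd]

lemma initialProd_eq_prod (q : Fin T → (Fin T → E) → ℝ≥0∞) (z : Fin T → E) :
    initialProd q T z = ∏ t, q t z := by
  simp [initialProd]

lemma IsCausal.initialProd_update {q : Fin T → (Fin T → E) → ℝ≥0∞} (hq : IsCausal q)
    (k : Fin T) (z : Fin T → E) (w : E) :
    initialProd q k (update z k w) = initialProd q k z := by
  refine Finset.prod_congr rfl fun t ht => hq t _ _ fun s hs => ?_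
  have hlt : t < k := by simpa using ht
  exact update_of_ne (ne_of_lt (lt_of_le_of_lt hs hlt)) _ _

lemma initialProd_ne_top {q : Fin T → (Fin T → E) → ℝ≥0∞} (hfin : ∀ t z, q t z ≠ ⊤) (k : ℕ)
    (z : Fin T → E) : initialProd q k z ≠ ⊤ :=
  ENNReal.prod_ne_top fun t _ => hfin t z

/-- If every factor is nonzero on a dense set of values of its own coordinate, then the initial
products are nonzero on a dense set of trajectories. -/
lemma dense_initialProd_ne_zero [TopologicalSpace E] {q : Fin T → (Fin T → E) → ℝ≥0∞}
    (hq : IsCausal q)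
    (hd : ∀ t z, Dense {w | q t (update z t w) ≠ 0}) (k : ℕ) (hk : k ≤ T) :
    Dense {z | initialProd q k z ≠ 0} := by
  induction k with
  | zero => simp [initialProd_zero]
  | succ k ih =>
    rw [dense_iff_inter_open]
    intro U hU hne
    obtain ⟨z, hzU, hz⟩ := (ih (Nat.le_of_succ_le hk)).inter_open_nonempty U hU hne
    let t : Fin T := ⟨k, hk⟩
    obtain ⟨w, hwU, hw⟩ := (hd t z).inter_open_nonempty ((fun w => update z t w) ⁻¹' U)
      (hU.preimage (continuous_const.update t continuous_id)) ⟨z t, by simpa using hzU⟩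
    refine ⟨update z t w, hwU, ?_⟩
    have h1 := initialProd_succ q t (update z t w)
    rw [hq.initialProd_update] at h1
    change initialProd q (k + 1) _ ≠ 0
    rw [show k + 1 = (t : ℕ) + 1 from rfl, h1]
    exact mul_ne_zero hz hw

variable [MeasureSpace E]

/-- Integrating out the last coordinate removes the last factor. -/
lemma lintegral_initialProd_update {q : Fin T → (Fin T → E) → ℝ≥0∞} (hq : IsCausal q)
    (hn : IsNormalized q) (hm : ∀ t, Measurable (q t)) (k : Fin T) (z : Fin T → E) :
    ∫⁻ w, initialProd q ((k : ℕ) + 1) (update z k w) = initialProd q k z := by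
  simp_rw [initialProd_succ, hq.initialProd_update]
  have hmk : Measurable fun w => q k (update z k w) := (hm k).comp (measurable_update z)
  rw [lintegral_const_mul _ hmk, hn, mul_one]

lemma lintegral_prod_eq_one [Nonempty E] [SigmaFinite (volume : Measure E)]
    {q : Fin T → (Fin T → E) → ℝ≥0∞} (hq : IsCausal q)
    (hn : IsNormalized q) (hm : ∀ t, Measurable (q t)) :
    ∫⁻ z, ∏ t, q t z = 1 := by
  have key : ∀ k ≤ T,
      (∫⋯∫⁻_(Finset.univ.filter (fun t : Fin T => (t : ℕ) < k)), initialProd q k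
        ∂(fun _ => (volume : Measure E))) = fun _ => 1 := by
    intro k
    induction k with
    | zero =>
      intro _
      have h0 : Finset.univ.filter (fun t : Fin T => (t : ℕ) < 0) = ∅ := by simp
      rw [h0, lmarginal_empty]
      exact funext fun z => initialProd_zero q z
    | succ k ih =>
      intro hk
      have hins := filter_lt_succ_eq_insert (⟨k, hk⟩ : Fin T)
      have hmeas : Measurable (initialProd q (k + 1)) := by
        unfold initialProd
        exact Finset.measurable_fun_prod _ fun t _ => hm t
      simp only at hins
      rw [hins, lmarginal_insert' _ hmeas (by simp), ← ih (Nat.le_of_succ_le hk)]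
      congr 1
      funext z
      exact lintegral_initialProd_update hq hn hm ⟨k, hk⟩ z
  have z : Fin T → E := Classical.arbitrary _
  have h := congrFun (key T le_rfl) z
  have hu : Finset.univ.filter (fun t : Fin T => (t : ℕ) < T) = Finset.univ := by simp
  rw [hu] at h
  rw [volume_pi, lintegral_eq_lmarginal_univ z, ← h]
  congr 2
  exact funext fun z => (initialProd_eq_prod q z).symm

/-- Two causal normalized families with the same full product have the same initial products:
integrate out the coordinates from the last one downwards. -/
lemma initialProd_eq_of_prod_eq {q r : Fin T → (Fin T → E) → ℝ≥0∞}
    (hq : IsCausal q) (hr : IsCausal r) (hnq : IsNormalized q) (hnr : IsNormalized r)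
    (hmq : ∀ t, Measurable (q t)) (hmr : ∀ t, Measurable (r t))
    (h : ∀ z, ∏ t, q t z = ∏ t, r t z) (k : ℕ) (hk : k ≤ T) (z : Fin T → E) :
    initialProd q k z = initialProd r k z := by
  induction hk using Nat.decreasingInduction generalizing z with
  | self => simpa [initialProd_eq_prod] using h z
  | of_succ k hk ih =>
    have h1 := lintegral_initialProd_update hq hnq hmq ⟨k, hk⟩ z
    have h2 := lintegral_initialProd_update hr hnr hmr ⟨k, hk⟩ z
    rw [← h1, ← h2]
    exact lintegral_congr fun w => ih _

variable [TopologicalSpace E]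

/-- Two continuous, causal, normalized families of factors with the same product are equal, as
soon as one of them is nonzero densely. -/
lemma causal_factors_eq [OpensMeasurableSpace (Fin T → E)]
    {q r : Fin T → (Fin T → E) → ℝ≥0∞}
    (hq : IsCausal q) (hr : IsCausal r) (hnq : IsNormalized q) (hnr : IsNormalized r)
    (hcq : ∀ t, Continuous (q t)) (hcr : ∀ t, Continuous (r t)) (hfin : ∀ t z, q t z ≠ ⊤)
    (hd : ∀ t z, Dense {w | q t (update z t w) ≠ 0})
    (h : ∀ z, ∏ t, q t z = ∏ t, r t z) (t : Fin T) : q t = r t := by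
  have hinit := initialProd_eq_of_prod_eq hq hr hnq hnr (fun t => (hcq t).measurable)
    (fun t => (hcr t).measurable) h
  refine Continuous.ext_on (dense_initialProd_ne_zero hq hd t t.isLt.le) (hcq t) (hcr t) ?_
  intro z hz
  have h1 := hinit _ t.isLt z
  rw [initialProd_succ, initialProd_succ, ← hinit _ t.isLt.le z] at h1
  exact (ENNReal.mul_right_inj hz (initialProd_ne_top hfin _ z)).mp h1

/-- A continuous density that is nonzero on a dense set charges every nonempty open set. -/
lemma isOpenPosMeasure_withDensity {X : Type*} [TopologicalSpace X] [MeasurableSpace X]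
    [OpensMeasurableSpace X] (μ : Measure X) [μ.IsOpenPosMeasure] {Q : X → ℝ≥0∞}
    (hQ : Continuous Q) (hd : Dense {x | Q x ≠ 0}) : (μ.withDensity Q).IsOpenPosMeasure := by
  refine ⟨fun U hU hne h0 => ?_⟩
  have hO : IsOpen (U ∩ {x | Q x ≠ 0}) := hU.inter (isOpen_ne.preimage hQ)
  rw [withDensity_apply _ hU.measurableSet, lintegral_eq_zero_iff hQ.measurable,
    EventuallyEq, ae_restrict_iff' hU.measurableSet] at h0
  refine hO.measure_ne_zero μ (hd.inter_open_nonempty U hU hne) ?_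
  refine measure_mono_null ?_ h0
  rintro x ⟨hxU, hx⟩ h
  exact hx (h hxU)

end Causal

/-! ### Deconvolution and change of variables -/

/-- Convolution with a measure whose characteristic function has no zero is injective. -/
lemma eq_of_conv_eq {F : Type*} [NormedAddCommGroup F] [NormedSpace ℝ F] [MeasurableSpace F]
    [BorelSpace F] [CompleteSpace F] [SecondCountableTopology F] {μ ν N : Measure F}
    [IsFiniteMeasure μ] [IsFiniteMeasure ν] [IsFiniteMeasure N]
    (hN : ∀ L, charFunDual N L ≠ 0) (h : μ ∗ N = ν ∗ N) : μ = ν := by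
  refine Measure.ext_of_charFunDual (funext fun L => ?_)
  have h1 : charFunDual (μ ∗ N) L = charFunDual (ν ∗ N) L := by rw [h]
  rw [charFunDual_conv, charFunDual_conv] at h1
  exact mul_right_cancel₀ (hN L) h1

instance isProbabilityMeasure_noiseLaw (T dx : ℕ) (σ2 : ℝ≥0) :
    IsProbabilityMeasure (LatentModel.noiseLaw T dx σ2) := by
  unfold LatentModel.noiseLaw
  infer_instance

/-- The characteristic function of the noise has no zero, also in the degenerate case of zero
variance. -/
lemma charFunDual_noiseLaw_ne_zero (T dx : ℕ) (σ2 : ℝ≥0)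
    (L : StrongDual ℝ (Fin T → Fin dx → ℝ)) : charFunDual (LatentModel.noiseLaw T dx σ2) L ≠ 0 := by
  rw [LatentModel.noiseLaw, charFunDual_pi]
  refine Finset.prod_ne_zero_iff.mpr fun t _ => ?_
  rw [charFunDual_pi]
  refine Finset.prod_ne_zero_iff.mpr fun i _ => ?_
  rw [IsGaussian.charFunDual_eq]
  exact Complex.exp_ne_zero _

/-- The change of variables `z ↦ (v (z t))ₜ` for a measure whose image has a density. -/
lemma eq_withDensity_of_map_eq {T m : ℕ} {v : (Fin m → ℝ) → (Fin m → ℝ)}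
    (hinj : Injective v) (hv : ContDiff ℝ 1 v)
    {μ : Measure (Fin T → Fin m → ℝ)} {Q : (Fin T → Fin m → ℝ) → ℝ≥0∞}
    (h : μ.map (fun z t => v (z t)) = volume.withDensity Q) :
    μ = volume.withDensity fun z =>
      (∏ t, ENNReal.ofReal |(fderiv ℝ v (z t)).det|) * Q (fun t => v (z t)) := by
  have hVinj : Injective fun (z : Fin T → Fin m → ℝ) t => v (z t) := fun z z' hz =>
    funext fun t => hinj (congrFun hz t)
  have hVc : Continuous fun (z : Fin T → Fin m → ℝ) t => v (z t) :=
    continuous_pi fun t => hv.continuous.comp (continuous_apply t)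
  have hder : ∀ z : Fin T → Fin m → ℝ, HasFDerivAt (fun (z : Fin T → Fin m → ℝ) t => v (z t))
      (ContinuousLinearMap.pi fun t =>
        (fderiv ℝ v (z t)).comp (ContinuousLinearMap.proj (R := ℝ) t)) z := fun z =>
    hasFDerivAt_pi.mpr fun t =>
      ((hv.differentiable one_ne_zero) (z t)).hasFDerivAt.comp z
        (ContinuousLinearMap.proj (R := ℝ) (φ := fun _ : Fin T => Fin m → ℝ) t).hasFDerivAt
  ext s hs
  have him : MeasurableSet ((fun (z : Fin T → Fin m → ℝ) t => v (z t)) '' s) :=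
    measurable_image_of_fderivWithin hs (fun z _ => (hder z).hasFDerivWithinAt) hVinj.injOn
  rw [← hVinj.preimage_image s, ← Measure.map_apply hVc.measurable him, h, withDensity_apply _ him,
    lintegral_image_eq_lintegral_abs_det_fderiv_mul volume hs
      (fun z _ => (hder z).hasFDerivWithinAt) hVinj.injOn, hVinj.preimage_image s,
    withDensity_apply _ hs]
  refine lintegral_congr fun z => ?_
  rw [ContinuousLinearMap.det_pi, Finset.abs_prod, ENNReal.ofReal_prod_of_nonneg]
  exact fun _ _ => abs_nonneg _

/-! ### Second derivatives -/

lemma hasFDerivAt_fderiv_of_contDiffAt {V : Type*} [NormedAddCommGroup V] [NormedSpace ℝ V]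
    {F : V → ℝ} {y : V} (hF : ContDiffAt ℝ 2 F y) :
    HasFDerivAt (fderiv ℝ F) (fderiv ℝ (fderiv ℝ F) y) y := by
  have h1 : ContDiffAt ℝ 1 (fderiv ℝ F) y := hF.fderiv_right (by norm_num)
  exact (h1.differentiableAt one_ne_zero).hasFDerivAt

lemma fderiv_fderiv_apply {V : Type*} [NormedAddCommGroup V] [NormedSpace ℝ V]
    {F : V → ℝ} {y : V} (hF : ContDiffAt ℝ 2 F y) (c e : V) :
    fderiv ℝ (fun y => fderiv ℝ F y c) y e = fderiv ℝ (fderiv ℝ F) y e c := by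
  rw [((hasFDerivAt_fderiv_of_contDiffAt hF).clm_apply (hasFDerivAt_const c y)).fderiv]
  simp

/-- If `F (γ s + u • e)` is locally the sum of a function of `s` and a function of `u`, then the
second derivative of `F` vanishes in the directions `e` and `γ' 0`. The curve `γ` need only be
differentiable, since the differentiation along `e` is performed first. -/
lemma fderiv_fderiv_eq_zero_of_separated {V : Type*} [NormedAddCommGroup V] [NormedSpace ℝ V]
    {F : V → ℝ} {γ : ℝ → V} {d e : V} (hF : ContDiffAt ℝ 2 F (γ 0)) (hγ : HasDerivAt γ d 0)
    (hsep : ∀ᶠ s in 𝓝 (0 : ℝ), ∃ c : ℝ, ∀ᶠ u in 𝓝 (0 : ℝ),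
      F (γ s + u • e) = F (γ 0 + u • e) + c) :
    fderiv ℝ (fderiv ℝ F) (γ 0) e d = 0 := by
  have hev : ∀ᶠ y in 𝓝 (γ 0), DifferentiableAt ℝ F y :=
    (hF.eventually (by simp)).mono fun y hy => hy.differentiableAt two_ne_zero
  have hdir : ∀ s, DifferentiableAt ℝ F (γ s) →
      HasDerivAt (fun u : ℝ => F (γ s + u • e)) (fderiv ℝ F (γ s) e) 0 := by
    intro s hs
    have hline : HasDerivAt (fun u : ℝ => γ s + u • e) e 0 := by
      simpa using ((hasDerivAt_id (0 : ℝ)).smul_const e).const_add (γ s)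
    have hs' : HasFDerivAt F (fderiv ℝ F (γ s)) (γ s + (0 : ℝ) • e) := by
      simpa using hs.hasFDerivAt
    exact hs'.comp_hasDerivAt (0 : ℝ) hline
  have hconst : (fun s => fderiv ℝ F (γ s) e) =ᶠ[𝓝 0] fun _ => fderiv ℝ F (γ 0) e := by
    filter_upwards [hsep, hγ.continuousAt.eventually hev] with s ⟨c, hc⟩ hs
    have h0 := (hdir 0 hev.self_of_nhds).add_const c
    exact (hdir s hs).unique (h0.congr_of_eventuallyEq hc)
  have h1 : HasDerivAt (fun s => fderiv ℝ F (γ s) e) (fderiv ℝ (fderiv ℝ F) (γ 0) d e) 0 := by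
    have h2 : HasDerivAt (fun s => fderiv ℝ F (γ s)) (fderiv ℝ (fderiv ℝ F) (γ 0) d) 0 :=
      (hasFDerivAt_fderiv_of_contDiffAt hF).comp_hasDerivAt (0 : ℝ) hγ
    simpa using h2.clm_apply (hasDerivAt_const (0 : ℝ) e)
  have h3 := h1.unique ((hasDerivAt_const (0 : ℝ) _).congr_of_eventuallyEq hconst)
  exact ((hF.isSymmSndFDerivAt (by simp)) e d).trans h3

/-! ### Transition densities -/

lemma seqs_eq_pi {da : ℕ} (A : Set (Fin da → ℝ)) (k : ℕ) :
    seqs A k = Set.pi Set.univ fun _ => A := by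
  ext a
  simp [seqs]

variable {T dz dx da : ℕ}

namespace LatentModel

variable {A : Set (Fin da → ℝ)} {θ : LatentModel T dz dx da}

/-- The set `ℝ^{dz} × ℝ^{dz × (t-1)} × 𝒜ᵗ` on which the transition density lives. -/
abbrev domain (dz : ℕ) (A : Set (Fin da → ℝ)) (t : Fin T) :
    Set ((Fin dz → ℝ) × (Fin (t : ℕ) → Fin dz → ℝ) × (Fin ((t : ℕ) + 1) → Fin da → ℝ)) :=
  Set.univ ×ˢ (Set.univ ×ˢ seqs A ((t : ℕ) + 1))

/-- The transition density is `C²` as the product of its mechanisms. -/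
lemma CondIndep.ckOn (hci : θ.CondIndep A) (hs : θ.SmoothTransition A) (t : Fin T) :
    CkOn 2 (domain dz A t) (fun x => θ.p t x.1 x.2.1 x.2.2) := by
  choose g U hU hSU hg heq using hs.2 t
  let φ : Fin dz → (Fin dz → ℝ) × (Fin (t : ℕ) → Fin dz → ℝ) × (Fin ((t : ℕ) + 1) → Fin da → ℝ) →
      ℝ × (Fin (t : ℕ) → Fin dz → ℝ) × (Fin ((t : ℕ) + 1) → Fin da → ℝ) :=
    fun i x => (x.1 i, x.2)
  have hφ : ∀ i, ContDiff ℝ 2 (φ i) := fun i => by fun_prop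
  refine ⟨fun x => ∏ i, g i (φ i x), ⋂ i, φ i ⁻¹' U i,
    isOpen_iInter_of_finite fun i => (hU i).preimage (hφ i).continuous, ?_, ?_, ?_⟩
  · intro x hx
    simp only [Set.mem_iInter, Set.mem_preimage]
    exact fun i => hSU i ⟨Set.mem_univ _, hx.2⟩
  · refine contDiffOn_prod fun i _ => ?_
    exact (hg i).comp (hφ i).contDiffOn fun x hx => Set.mem_iInter.mp hx i
  · intro x hx
    have h := (hci t x.2.1 x.2.2 hx.2.2).2.2.2.1 x.1
    simp only [h]
    exact Finset.prod_congr rfl fun i _ => heq i ⟨Set.mem_univ _, hx.2⟩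

lemma CondIndep.isCkExtension (hci : θ.CondIndep A) (hs : θ.SmoothTransition A) (t : Fin T) :
    IsCkExtension 2 (domain dz A t) (fun x => θ.p t x.1 x.2.1 x.2.2)
      (ckExtension 2 (domain dz A t) fun x => θ.p t x.1 x.2.1 x.2.2) := by
  rw [ckExtension, dif_pos (hci.ckOn hs t)]
  exact (hci.ckOn hs t).choose_spec

lemma CondIndep.continuousOn (hci : θ.CondIndep A) (hs : θ.SmoothTransition A) (t : Fin T) :
    ContinuousOn (fun x : (Fin dz → ℝ) × (Fin (t : ℕ) → Fin dz → ℝ) ×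
      (Fin ((t : ℕ) + 1) → Fin da → ℝ) => θ.p t x.1 x.2.1 x.2.2) (domain dz A t) := by
  obtain ⟨g, U, -, hSU, hg, heq⟩ := hci.ckOn hs t
  exact (hg.continuousOn.mono hSU).congr fun x hx => (heq hx).symm

lemma CondIndep.logDensity_eq (hci : θ.CondIndep A) (hs : θ.SmoothTransition A) (t : Fin T)
    (z : Fin dz → ℝ) (zh : Fin (t : ℕ) → Fin dz → ℝ) {ah : Fin ((t : ℕ) + 1) → Fin da → ℝ}
    (hah : ah ∈ seqs A ((t : ℕ) + 1)) :
    θ.logDensity A t (z, zh, ah) = Real.log (θ.p t z zh ah) := by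
  obtain ⟨U, -, -, -, heq⟩ := hci.isCkExtension hs t
  exact congrArg Real.log (heq (x := (z, zh, ah)) ⟨Set.mem_univ _, Set.mem_univ _, hah⟩)

lemma CondIndep.contDiffAt_logDensity (hci : θ.CondIndep A) (hs : θ.SmoothTransition A)
    (t : Fin T) {z : Fin dz → ℝ} {zh : Fin (t : ℕ) → Fin dz → ℝ}
    {ah : Fin ((t : ℕ) + 1) → Fin da → ℝ} (hah : ah ∈ seqs A ((t : ℕ) + 1))
    (hpos : 0 < θ.p t z zh ah) : ContDiffAt ℝ 2 (θ.logDensity A t) (z, zh, ah) := by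
  obtain ⟨U, hU, hSU, hg, heq⟩ := hci.isCkExtension hs t
  have hmem : (z, zh, ah) ∈ domain dz A t := ⟨Set.mem_univ _, Set.mem_univ _, hah⟩
  refine (hg.contDiffAt (hU.mem_nhds (hSU hmem))).log ?_
  rw [heq hmem]
  exact hpos.ne'

/-- Positivity of the density is an open condition in the history and the latent vector, relative
to `𝒜ᵗ`. -/
lemma CondIndep.eventually_pos (hci : θ.CondIndep A) (hs : θ.SmoothTransition A)
    (t : Fin T) {z : Fin dz → ℝ} {zh : Fin (t : ℕ) → Fin dz → ℝ}
    {ah : Fin ((t : ℕ) + 1) → Fin da → ℝ} (hah : ah ∈ seqs A ((t : ℕ) + 1))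
    (hpos : 0 < θ.p t z zh ah) :
    ∀ᶠ x in 𝓝[domain dz A t] (z, zh, ah), 0 < θ.p t x.1 x.2.1 x.2.2 :=
  (hci.continuousOn hs t (z, zh, ah) ⟨Set.mem_univ _, Set.mem_univ _, hah⟩).eventually
    (lt_mem_nhds hpos)

/-- A density whose distribution has full support is positive on a dense set. -/
lemma CondIndep.dense_pos (hci : θ.CondIndep A) (t : Fin T)
    (zh : Fin (t : ℕ) → Fin dz → ℝ) {ah : Fin ((t : ℕ) + 1) → Fin da → ℝ}
    (hah : ah ∈ seqs A ((t : ℕ) + 1)) : Dense {z | 0 < θ.p t z zh ah} := by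
  have hmech : ∀ i, Dense {s | 0 < θ.mech t i s zh ah} := by
    intro i
    rw [dense_iff_inter_open]
    intro U hU ⟨s, hs⟩
    by_contra hemp
    rw [Set.not_nonempty_iff_eq_empty] at hemp
    have hsupp : s ∈ ((volume : Measure ℝ).withDensity
        fun s => ENNReal.ofReal (θ.mech t i s zh ah)).support := by
      rw [(hci t zh ah hah).2.2.2.2 i]
      trivial
    have hpos := (Measure.mem_support_iff_forall s).mp hsupp U (hU.mem_nhds hs)
    rw [withDensity_apply _ hU.measurableSet] at hpos
    refine hpos.ne' ?_
    rw [setLIntegral_congr_fun hU.measurableSet (g := fun _ => 0), lintegral_zero]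
    intro x hx
    refine ENNReal.ofReal_eq_zero.mpr (not_lt.mp fun h => ?_)
    exact (Set.eq_empty_iff_forall_notMem.mp hemp x) ⟨hx, h⟩
  refine (dense_pi Set.univ fun i _ => hmech i).mono fun z hz => ?_
  simp only [Set.mem_ofPred_eq]
  rw [(hci t zh ah hah).2.2.2.1 z]
  exact Finset.prod_pos fun i _ => hz i (Set.mem_univ i)

/-! ### The joint law of the latent variables -/

/-- The factors of the joint density of the latent trajectory. -/
noncomputable def factor (θ : LatentModel T dz dx da) (a : Fin T → Fin da → ℝ) (t : Fin T)
    (z : Fin T → Fin dz → ℝ) : ℝ≥0∞ :=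
  ENNReal.ofReal (θ.p t (z t) (zPast z t) (aPast a t))

lemma aPast_mem_seqs {a : Fin T → Fin da → ℝ} (ha : a ∈ seqs A T) (t : Fin T) :
    aPast a t ∈ seqs A ((t : ℕ) + 1) := fun _ => ha _

lemma zPast_update (z : Fin T → Fin dz → ℝ) (t : Fin T) (w : Fin dz → ℝ) :
    zPast (update z t w) t = zPast z t := by
  funext s
  exact update_of_ne (Fin.ne_of_lt (show Fin.castLE t.isLt.le s < t from s.isLt)) _ _

lemma isCausal_factor (θ : LatentModel T dz dx da) (a : Fin T → Fin da → ℝ) :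
    IsCausal (θ.factor a) := by
  intro t z z' h
  have h1 : zPast z t = zPast z' t := funext fun s => h _ (le_of_lt s.isLt)
  rw [factor, factor, h t le_rfl, h1]

lemma CondIndep.isNormalized_factor (hci : θ.CondIndep A) {a : Fin T → Fin da → ℝ}
    (ha : a ∈ seqs A T) : IsNormalized (θ.factor a) := by
  intro t z
  simp_rw [factor, zPast_update, update_self]
  exact (hci t _ _ (aPast_mem_seqs ha t)).2.2.1

lemma continuous_zPast (t : Fin T) : Continuous fun z : Fin T → Fin dz → ℝ => zPast z t :=
  continuous_pi fun _ => continuous_apply _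

lemma CondIndep.continuous_factor (hci : θ.CondIndep A) (hs : θ.SmoothTransition A)
    {a : Fin T → Fin da → ℝ} (ha : a ∈ seqs A T) (t : Fin T) : Continuous (θ.factor a t) :=
  ENNReal.continuous_ofReal.comp <| (hci.continuousOn hs t).comp_continuous
    (f := fun z : Fin T → Fin dz → ℝ => (z t, zPast z t, aPast a t))
    ((continuous_apply t).prodMk ((continuous_zPast t).prodMk continuous_const))
    fun _ => ⟨Set.mem_univ _, Set.mem_univ _, aPast_mem_seqs ha t⟩

lemma CondIndep.dense_factor_ne_zero (hci : θ.CondIndep A) {a : Fin T → Fin da → ℝ}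
    (ha : a ∈ seqs A T) (t : Fin T) (z : Fin T → Fin dz → ℝ) :
    Dense {w | θ.factor a t (update z t w) ≠ 0} := by
  refine (hci.dense_pos t (zPast z t) (aPast_mem_seqs ha t)).mono fun w hw => ?_
  simp only [Set.mem_ofPred_eq, factor, zPast_update, update_self]
  exact (ENNReal.ofReal_pos.mpr hw).ne'

lemma latentLaw_eq_withDensity_factor (θ : LatentModel T dz dx da) (a : Fin T → Fin da → ℝ) :
    θ.latentLaw a = volume.withDensity fun z => ∏ t, θ.factor a t z := rfl

lemma CondIndep.isProbabilityMeasure_latentLaw (hci : θ.CondIndep A) (hs : θ.SmoothTransition A)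
    {a : Fin T → Fin da → ℝ} (ha : a ∈ seqs A T) : IsProbabilityMeasure (θ.latentLaw a) := by
  constructor
  rw [latentLaw_eq_withDensity_factor, withDensity_apply _ MeasurableSet.univ, setLIntegral_univ]
  exact lintegral_prod_eq_one (isCausal_factor θ a) (hci.isNormalized_factor ha)
    fun t => (hci.continuous_factor hs ha t).measurable

lemma CondIndep.continuous_prod_factor (hci : θ.CondIndep A) (hs : θ.SmoothTransition A)
    {a : Fin T → Fin da → ℝ} (ha : a ∈ seqs A T) : Continuous fun z => ∏ t, θ.factor a t z := by
  simp_rw [factor]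
  have h : ∀ z : Fin T → Fin dz → ℝ,
      ∏ t, ENNReal.ofReal (θ.p t (z t) (zPast z t) (aPast a t)) =
        ENNReal.ofReal (∏ t, θ.p t (z t) (zPast z t) (aPast a t)) := fun z =>
    (ENNReal.ofReal_prod_of_nonneg fun t _ =>
      (hci t _ _ (aPast_mem_seqs ha t)).2.1 _).symm
  simp_rw [h]
  refine ENNReal.continuous_ofReal.comp (continuous_finsetProd _ fun t _ => ?_)
  exact (hci.continuousOn hs t).comp_continuous
    (f := fun z : Fin T → Fin dz → ℝ => (z t, zPast z t, aPast a t))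
    ((continuous_apply t).prodMk ((continuous_zPast t).prodMk continuous_const))
    fun _ => ⟨Set.mem_univ _, Set.mem_univ _, aPast_mem_seqs ha t⟩

lemma CondIndep.isOpenPosMeasure_latentLaw (hci : θ.CondIndep A) (hs : θ.SmoothTransition A)
    {a : Fin T → Fin da → ℝ} (ha : a ∈ seqs A T) : (θ.latentLaw a).IsOpenPosMeasure := by
  rw [latentLaw_eq_withDensity_factor]
  refine isOpenPosMeasure_withDensity _ (hci.continuous_prod_factor hs ha) ?_
  simpa only [initialProd_eq_prod] using
    dense_initialProd_ne_zero (isCausal_factor θ a) (hci.dense_factor_ne_zero ha) T le_rfl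

end LatentModel

/-! ### The entanglement map -/

section Entanglement

variable {m n : ℕ} {f f' : (Fin m → ℝ) → (Fin n → ℝ)}

lemma apply_invFun_comp (hr : Set.range f = Set.range f') (z : Fin m → ℝ) :
    f ((invFun f ∘ f') z) = f' z :=
  invFun_eq (hr ▸ Set.mem_range_self z : f' z ∈ Set.range f)

lemma leftInverse_invFun_comp (hf : Injective f)
    (hr : Set.range f = Set.range f') : LeftInverse (invFun f ∘ f') (invFun f' ∘ f) := by
  intro z
  refine hf ?_
  rw [apply_invFun_comp hr, apply_invFun_comp hr.symm]

lemma contDiff_invFun_comp (hf : IsDiffeoOntoImage f) (hf' : IsDiffeoOntoImage f')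
    (hr : Set.range f = Set.range f') : ContDiff ℝ 1 (invFun f ∘ f') := by
  obtain ⟨g, U, hU, hSU, hg, heq⟩ := hf.2.2
  have hmem : ∀ z, f' z ∈ Set.range f := fun z => hr ▸ Set.mem_range_self z
  have h : invFun f ∘ f' = g ∘ f' := funext fun z => (heq (hmem z)).symm
  rw [h, ← contDiffOn_univ]
  exact hg.comp hf'.2.1.contDiffOn fun z _ => hSU (hmem z)

lemma isDiffeo_of_inverse {v w : (Fin m → ℝ) → (Fin m → ℝ)} (hv : ContDiff ℝ 1 v)
    (hw : ContDiff ℝ 1 w) (hl : LeftInverse w v) (hr : LeftInverse v w) : IsDiffeo v := by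
  refine ⟨⟨hl.injective, hr.surjective⟩, hv, ?_⟩
  have h : invFun v = w := funext fun z => hl.injective (by
    rw [invFun_eq ⟨w z, hr z⟩, hr z])
  rwa [h]

lemma isDiffeo_invFun_comp (hf : IsDiffeoOntoImage f) (hf' : IsDiffeoOntoImage f')
    (hr : Set.range f = Set.range f') : IsDiffeo (invFun f ∘ f') :=
  isDiffeo_of_inverse (contDiff_invFun_comp hf hf' hr) (contDiff_invFun_comp hf' hf hr.symm)
    (leftInverse_invFun_comp hf'.1 hr.symm) (leftInverse_invFun_comp hf.1 hr)

lemma IsDiffeo.det_fderiv_ne_zero {v : (Fin m → ℝ) → (Fin m → ℝ)} (hv : IsDiffeo v)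
    (z : Fin m → ℝ) : (fderiv ℝ v z).det ≠ 0 := by
  have h1 := (hv.2.1.differentiable one_ne_zero z).hasFDerivAt
  have h2 := (hv.2.2.differentiable one_ne_zero (v z)).hasFDerivAt
  have h3 : HasFDerivAt (invFun v ∘ v) ((fderiv ℝ (invFun v) (v z)).comp (fderiv ℝ v z)) z :=
    h2.comp z h1
  have hid : invFun v ∘ v = id := funext (leftInverse_invFun hv.1.1)
  rw [hid] at h3
  have h4 := h3.unique (hasFDerivAt_id z)
  intro h0
  have h5 : ((fderiv ℝ (invFun v) (v z)).comp (fderiv ℝ v z)).det = 1 := by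
    rw [h4]
    simp [ContinuousLinearMap.det]
  rw [ContinuousLinearMap.det, ContinuousLinearMap.toLinearMap_comp, LinearMap.det_comp] at h5
  change _ * (fderiv ℝ v z).det = 1 at h5
  rw [h0, mul_zero] at h5
  exact zero_ne_one h5

lemma IsDiffeo.continuous_det {v : (Fin m → ℝ) → (Fin m → ℝ)} (hv : IsDiffeo v) :
    Continuous fun z => (fderiv ℝ v z).det :=
  ContinuousLinearMap.continuous_det.comp (hv.2.1.continuous_fderiv one_ne_zero)

lemma IsDiffeo.apply_invFun {v : (Fin m → ℝ) → (Fin m → ℝ)} (hv : IsDiffeo v) (z : Fin m → ℝ) :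
    v (invFun v z) = z :=
  rightInverse_invFun hv.1.2 z

end Entanglement

namespace LatentModel

variable {A : Set (Fin da → ℝ)} {θ θ' : LatentModel T dz dx da} {σ2 : ℝ≥0}

/-! ### Observational equivalence implies equivalence up to diffeomorphism -/

lemma ObservationModel.continuous (h : θ.ObservationModel) : Continuous θ.f :=
  h.2.1.2.1.continuous

lemma continuous_decodeTrajectory (h : θ.ObservationModel) :
    Continuous fun (z : Fin T → Fin dz → ℝ) t => θ.f (z t) :=
  continuous_pi fun t => h.continuous.comp (continuous_apply t)

/-- The law of the observations is the law of the decoded latent trajectory convolved with the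
law of the noise. -/
lemma obsLaw_eq_conv (h : θ.ObservationModel) (a : Fin T → Fin da → ℝ)
    [IsProbabilityMeasure (θ.latentLaw a)] :
    θ.obsLaw σ2 a = ((θ.latentLaw a).map fun z t => θ.f (z t)) ∗ noiseLaw T dx σ2 := by
  have hm := (continuous_decodeTrajectory h).measurable
  have h2 : (noiseLaw T dx σ2) = (noiseLaw T dx σ2).map id := Measure.map_id.symm
  rw [Measure.conv]
  conv_rhs => rw [h2, Measure.map_prod_map _ _ hm measurable_id]
  rw [Measure.map_map (by fun_prop) (hm.prodMap measurable_id)]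
  rfl

/-- The noise can be removed: the decoded latent trajectories have the same law. -/
lemma ObsEquiv.map_latentLaw_eq (hequiv : ObsEquiv σ2 A θ θ')
    (hobs : θ.ObservationModel) (hobs' : θ'.ObservationModel)
    (hci : θ.CondIndep A) (hci' : θ'.CondIndep A)
    (hs : θ.SmoothTransition A) (hs' : θ'.SmoothTransition A)
    {a : Fin T → Fin da → ℝ} (ha : a ∈ seqs A T) :
    ((θ.latentLaw a).map fun z t => θ.f (z t)) = (θ'.latentLaw a).map fun z t => θ'.f (z t) := by
  have := hci.isProbabilityMeasure_latentLaw hs ha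
  have := hci'.isProbabilityMeasure_latentLaw hs' ha
  have h := hequiv a ha
  rw [obsLaw_eq_conv hobs, obsLaw_eq_conv hobs'] at h
  exact eq_of_conv_eq (charFunDual_noiseLaw_ne_zero T dx σ2) h

lemma range_subset_of_map_latentLaw_eq (hT : 0 < T)
    (hobs : θ.ObservationModel) (hobs' : θ'.ObservationModel)
    {a : Fin T → Fin da → ℝ} [(θ.latentLaw a).IsOpenPosMeasure]
    (h : ((θ.latentLaw a).map fun z t => θ.f (z t)) =
      (θ'.latentLaw a).map fun z t => θ'.f (z t)) :
    Set.range θ.f ⊆ Set.range θ'.f := by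
  rintro _ ⟨z, rfl⟩
  by_contra hz
  let O : Set (Fin T → Fin dx → ℝ) := (fun x => x ⟨0, hT⟩) ⁻¹' (Set.range θ'.f)ᶜ
  have hO : IsOpen O := hobs'.2.2.isOpen_compl.preimage (continuous_apply _)
  have hF := continuous_decodeTrajectory hobs
  have h1 := DFunLike.congr_fun h O
  rw [Measure.map_apply hF.measurable hO.measurableSet,
    Measure.map_apply (continuous_decodeTrajectory hobs').measurable hO.measurableSet] at h1
  have h2 : ((fun (z : Fin T → Fin dz → ℝ) t => θ'.f (z t)) ⁻¹' O) = ∅ := by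
    ext y
    simp [O]
  rw [h2, measure_empty] at h1
  exact (hO.preimage hF).measure_ne_zero _ ⟨fun _ => z, hz⟩ h1

/-- The image of the second latent law under the entanglement map is the first latent law. -/
lemma map_entanglement_latentLaw (hobs : θ.ObservationModel) (hobs' : θ'.ObservationModel)
    (hr : Set.range θ.f = Set.range θ'.f) {a : Fin T → Fin da → ℝ}
    (h : ((θ.latentLaw a).map fun z t => θ.f (z t)) =
      (θ'.latentLaw a).map fun z t => θ'.f (z t)) :
    ((θ'.latentLaw a).map fun z t => entanglement θ θ' (z t)) = θ.latentLaw a := by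
  have hF := continuous_decodeTrajectory hobs
  have hemb : MeasurableEmbedding fun (z : Fin T → Fin dz → ℝ) t => θ.f (z t) :=
    hF.measurableEmbedding fun z z' hz => funext fun t => hobs.2.1.1 (congrFun hz t)
  have hV : Measurable fun (z : Fin T → Fin dz → ℝ) t => entanglement θ θ' (z t) :=
    (continuous_pi fun t => (contDiff_invFun_comp hobs.2.1 hobs'.2.1 hr).continuous.comp
      (continuous_apply t)).measurable
  rw [← hemb.comap_map (θ.latentLaw a), h, ← hemb.comap_map (Measure.map _ (θ'.latentLaw a)),
    Measure.map_map hF.measurable hV]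
  congr 2
  funext z t
  exact apply_invFun_comp hr (z t)

/-- The factors of the first model transported by the map `v`, with the Jacobian factor. -/
noncomputable def pulledFactor (θ : LatentModel T dz dx da) (v : (Fin dz → ℝ) → (Fin dz → ℝ))
    (a : Fin T → Fin da → ℝ) (t : Fin T) (z : Fin T → Fin dz → ℝ) : ℝ≥0∞ :=
  ENNReal.ofReal (θ.p t (v (z t)) (fun s => v (zPast z t s)) (aPast a t) *
    |(fderiv ℝ v (z t)).det|)

lemma pulledFactor_eq (θ : LatentModel T dz dx da) (v : (Fin dz → ℝ) → (Fin dz → ℝ))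
    (a : Fin T → Fin da → ℝ) (t : Fin T) (z : Fin T → Fin dz → ℝ) :
    θ.pulledFactor v a t z =
      ENNReal.ofReal |(fderiv ℝ v (z t)).det| * θ.factor a t (fun s => v (z s)) := by
  rw [pulledFactor, mul_comm, ENNReal.ofReal_mul (abs_nonneg _)]
  rfl

lemma isCausal_pulledFactor (θ : LatentModel T dz dx da) (v : (Fin dz → ℝ) → (Fin dz → ℝ))
    (a : Fin T → Fin da → ℝ) : IsCausal (θ.pulledFactor v a) := by
  intro t z z' h
  rw [pulledFactor_eq, pulledFactor_eq, h t le_rfl,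
    isCausal_factor θ a t (fun s => v (z s)) (fun s => v (z' s)) fun s hs => by rw [h s hs]]

lemma CondIndep.isNormalized_pulledFactor (hci : θ.CondIndep A)
    {v : (Fin dz → ℝ) → (Fin dz → ℝ)} (hv : IsDiffeo v) {a : Fin T → Fin da → ℝ}
    (ha : a ∈ seqs A T) : IsNormalized (θ.pulledFactor v a) := by
  intro t z
  have hupd : ∀ w, (fun s => v (update z t w s)) = update (fun s => v (z s)) t (v w) := by
    intro w
    funext s
    by_cases hst : s = t
    · subst hst
      simp
    · simp [update_of_ne hst]
  simp_rw [pulledFactor_eq, update_self, hupd]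
  have h := lintegral_image_eq_lintegral_abs_det_fderiv_mul (volume : Measure (Fin dz → ℝ))
    MeasurableSet.univ
    (fun z _ => (hv.2.1.differentiable one_ne_zero z).hasFDerivAt.hasFDerivWithinAt)
    hv.1.1.injOn (fun w => θ.factor a t (update (fun s => v (z s)) t w))
  rw [setLIntegral_univ, Set.image_univ, hv.1.2.range_eq, setLIntegral_univ] at h
  rw [← h]
  exact hci.isNormalized_factor ha t _

lemma CondIndep.continuous_pulledDensity (hci : θ.CondIndep A) (hs : θ.SmoothTransition A)
    {v : (Fin dz → ℝ) → (Fin dz → ℝ)} (hv : IsDiffeo v) {a : Fin T → Fin da → ℝ}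
    (ha : a ∈ seqs A T) (t : Fin T) :
    Continuous fun z : Fin T → Fin dz → ℝ =>
      θ.p t (v (z t)) (fun s => v (zPast z t s)) (aPast a t) * |(fderiv ℝ v (z t)).det| := by
  refine Continuous.mul ?_ (hv.continuous_det.comp (continuous_apply t)).abs
  refine (hci.continuousOn hs t).comp_continuous
    (f := fun z : Fin T → Fin dz → ℝ => (v (z t), fun s => v (zPast z t s), aPast a t)) ?_
    fun _ => ⟨Set.mem_univ _, Set.mem_univ _, aPast_mem_seqs ha t⟩
  have hvc := hv.2.1.continuous
  exact (hvc.comp (continuous_apply t)).prodMk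
    ((continuous_pi fun s => hvc.comp (continuous_apply _)).prodMk continuous_const)

lemma aPast_surj (hA : A.Nonempty) (t : Fin T) {ah : Fin ((t : ℕ) + 1) → Fin da → ℝ}
    (hah : ah ∈ seqs A ((t : ℕ) + 1)) : ∃ a ∈ seqs A T, aPast a t = ah := by
  obtain ⟨a0, ha0⟩ := hA
  refine ⟨fun s => if h : (s : ℕ) < (t : ℕ) + 1 then ah ⟨s, h⟩ else a0, fun s => ?_, ?_⟩
  · by_cases h : (s : ℕ) < (t : ℕ) + 1
    · simpa [h] using hah _
    · simpa [h] using ha0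
  · funext s
    have h : ((Fin.castLE t.isLt s : Fin T) : ℕ) < (t : ℕ) + 1 := s.isLt
    simp only [aPast, dif_pos h]
    rfl

lemma zPast_surj (t : Fin T) (z : Fin dz → ℝ) (zh : Fin (t : ℕ) → Fin dz → ℝ) :
    ∃ y : Fin T → Fin dz → ℝ, y t = z ∧ zPast y t = zh := by
  refine ⟨fun s => if h : (s : ℕ) < (t : ℕ) then zh ⟨s, h⟩ else z, by simp, ?_⟩
  funext s
  have h : ((Fin.castLE t.isLt.le s : Fin T) : ℕ) < (t : ℕ) := s.isLt
  simp only [zPast, dif_pos h]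
  rfl

/-- Observationally equivalent models are equivalent up to diffeomorphism. -/
theorem ObsEquiv.diffEquiv (hequiv : ObsEquiv σ2 A θ θ') (hT : 0 < T) (hA : A.Nonempty)
    (hobs : θ.ObservationModel) (hobs' : θ'.ObservationModel)
    (hci : θ.CondIndep A) (hci' : θ'.CondIndep A)
    (hs : θ.SmoothTransition A) (hs' : θ'.SmoothTransition A) : DiffEquiv A θ θ' := by
  have hmap : ∀ a ∈ seqs A T, ((θ.latentLaw a).map fun z t => θ.f (z t)) =
      (θ'.latentLaw a).map fun z t => θ'.f (z t) := fun a ha =>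
    hequiv.map_latentLaw_eq hobs hobs' hci hci' hs hs' ha
  have hr : Set.range θ.f = Set.range θ'.f := by
    obtain ⟨a0, ha0⟩ := hA
    have ha : (fun _ => a0) ∈ seqs A T := fun _ => ha0
    have := hci.isOpenPosMeasure_latentLaw hs ha
    have := hci'.isOpenPosMeasure_latentLaw hs' ha
    exact (range_subset_of_map_latentLaw_eq hT hobs hobs' (hmap _ ha)).antisymm
      (range_subset_of_map_latentLaw_eq hT hobs' hobs (hmap _ ha).symm)
  have hv : IsDiffeo (entanglement θ θ') := isDiffeo_invFun_comp hobs.2.1 hobs'.2.1 hr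
  refine ⟨hr, hv, fun t ah hah zh z => ?_⟩
  obtain ⟨a, ha, rfl⟩ := aPast_surj hA t hah
  obtain ⟨y, rfl, rfl⟩ := zPast_surj t z zh
  have hcr : ∀ t, Continuous (θ.pulledFactor (entanglement θ θ') a t) := fun t =>
    ENNReal.continuous_ofReal.comp (hci.continuous_pulledDensity hs hv ha t)
  have hpr0 : ∀ t z, 0 ≤ θ.p t (entanglement θ θ' (z t))
      (fun s => entanglement θ θ' (zPast z t s)) (aPast a t) *
        |(fderiv ℝ (entanglement θ θ') (z t)).det| := fun t z =>
    mul_nonneg ((hci t _ _ (aPast_mem_seqs ha t)).2.1 _) (abs_nonneg _)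
  have hcprod : Continuous fun z => ∏ t, θ.pulledFactor (entanglement θ θ') a t z := by
    simp_rw [pulledFactor]
    simp_rw [← ENNReal.ofReal_prod_of_nonneg fun t _ => hpr0 t _]
    exact ENNReal.continuous_ofReal.comp
      (continuous_finsetProd _ fun t _ => hci.continuous_pulledDensity hs hv ha t)
  have hlaw := eq_withDensity_of_map_eq hv.1.1 hv.2.1
    ((map_entanglement_latentLaw hobs hobs' hr (hmap a ha)).trans
      (latentLaw_eq_withDensity_factor θ a))
  simp_rw [← Finset.prod_mul_distrib, ← pulledFactor_eq] at hlaw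
  rw [latentLaw_eq_withDensity_factor] at hlaw
  have hc' := hci'.continuous_prod_factor hs' ha
  have hae := (withDensity_eq_iff_of_sigmaFinite hc'.measurable.aemeasurable
    hcprod.measurable.aemeasurable).mp hlaw
  have hprod := (Continuous.ae_eq_iff_eq volume hc' hcprod).mp hae
  have hfac := causal_factors_eq (isCausal_factor θ' a) (isCausal_pulledFactor θ _ a)
    (hci'.isNormalized_factor ha) (hci.isNormalized_pulledFactor hv ha)
    (hci'.continuous_factor hs' ha) hcr (fun _ _ => ENNReal.ofReal_ne_top)
    (hci'.dense_factor_ne_zero ha) (congrFun hprod) t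
  exact (ENNReal.ofReal_eq_ofReal_iff ((hci' t _ _ (aPast_mem_seqs ha t)).2.1 _)
    (hpr0 t y)).mp (congrFun hfac y)

/-! ### The support of the Jacobian of the entanglement map -/

/-- If `a_l` does not act on the factor `i`, then the density factors along the coordinate `i` of
the latent vector and the coordinate `l` of the auxiliary vector of time `τ`. -/
lemma MarkovGraph.p_add_single (hci : θ.CondIndep A) (hgraph : θ.MarkovGraph A) {t : Fin T}
    (τ : Fin ((t : ℕ) + 1)) {z : Fin dz → ℝ} {zh : Fin (t : ℕ) → Fin dz → ℝ}
    {ah : Fin ((t : ℕ) + 1) → Fin da → ℝ} (hah : ah ∈ seqs A ((t : ℕ) + 1))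
    {i : Fin dz} {l : Fin da} (hil : θ.Ga i l = false) (s u : ℝ)
    (hu : ah + u •
      (Pi.single τ (Pi.single l 1) : Fin ((t : ℕ) + 1) → Fin da → ℝ) ∈ seqs A ((t : ℕ) + 1)) :
    θ.p t (z + s • Pi.single i 1) zh
        (ah + u • (Pi.single τ (Pi.single l 1) : Fin ((t : ℕ) + 1) → Fin da → ℝ)) =
      θ.mech t i (z i + s) zh ah * ∏ k ∈ Finset.univ.erase i, θ.mech t k (z k) zh
        (ah + u • (Pi.single τ (Pi.single l 1) : Fin ((t : ℕ) + 1) → Fin da → ℝ)) := by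
  rw [(hci t zh _ hu).2.2.2.1, ← Finset.mul_prod_erase _ _ (Finset.mem_univ i)]
  congr 1
  · have h := hgraph t i (z i + s) zh zh _ hu ah hah (fun _ _ _ => rfl) (by
      intro r l' hl'
      have hne : l' ≠ l := by
        rintro rfl
        simp [hil] at hl'
      by_cases hr : r = τ
      · subst hr
        simp [hne]
      · simp [hr])
    simpa using h
  · refine Finset.prod_congr rfl fun k hk => ?_
    have hne : k ≠ i := Finset.ne_of_mem_erase hk
    simp [hne]

/-- At histories in the interior of `𝒜ᵗ`, the transported log-density has a vanishing mixed
derivative along `a_l` and `z_i` whenever `a_l` does not act on the factor `i` of the second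
model. -/
lemma DiffEquiv.mixed_derivative_eq_zero_of_interior (hd : DiffEquiv A θ θ')
    (hci : θ.CondIndep A) (hci' : θ'.CondIndep A)
    (hs : θ.SmoothTransition A) (hs' : θ'.SmoothTransition A) (hgraph' : θ'.MarkovGraph A)
    {t : Fin T} (τ : Fin ((t : ℕ) + 1)) {z : Fin dz → ℝ} {zh : Fin (t : ℕ) → Fin dz → ℝ}
    {ah : Fin ((t : ℕ) + 1) → Fin da → ℝ} (hah : ah ∈ seqs (interior A) ((t : ℕ) + 1))
    (hpos : 0 < θ'.p t z zh ah) {i : Fin dz} {l : Fin da} (hil : θ'.Ga i l = false) :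
    fderiv ℝ (fderiv ℝ (θ.logDensity A t))
      (entanglement θ θ' z, fun s => entanglement θ θ' (zh s), ah)
      (0, 0, Pi.single τ (Pi.single l 1))
      (fderiv ℝ (entanglement θ θ') z (Pi.single i 1), 0, 0) = 0 := by
  obtain ⟨-, hv, hp⟩ := hd
  have hsub : seqs (interior A) ((t : ℕ) + 1) ⊆ seqs A ((t : ℕ) + 1) :=
    fun _ h s => interior_subset (h s)
  have hopen : IsOpen (seqs (interior A) ((t : ℕ) + 1)) := by
    rw [seqs_eq_pi]
    exact isOpen_set_pi Set.finite_univ fun _ _ => isOpen_interior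
  have hahA := hsub hah
  set v := entanglement θ θ' with hvdef
  set e : Fin ((t : ℕ) + 1) → Fin da → ℝ := Pi.single τ (Pi.single l 1) with he
  have hdet : ∀ z, (0 : ℝ) < |(fderiv ℝ v z).det| := fun z => abs_pos.mpr (hv.det_fderiv_ne_zero z)
  have hposθ : 0 < θ.p t (v z) (fun s => v (zh s)) ah :=
    pos_of_mul_pos_left ((hp t ah hahA zh z) ▸ hpos) (abs_nonneg _)
  have hz0 : z + (0 : ℝ) • (Pi.single i 1 : Fin dz → ℝ) = z := by simp
  have hah0 : ah + (0 : ℝ) • e = ah := by simp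
  -- the curve along which the latent vector moves in the coordinate `i`
  let γ : ℝ → (Fin dz → ℝ) × (Fin (t : ℕ) → Fin dz → ℝ) × (Fin ((t : ℕ) + 1) → Fin da → ℝ) :=
    fun s => (v (z + s • Pi.single i 1), fun s => v (zh s), ah)
  have hγ0 : γ 0 = (v z, fun s => v (zh s), ah) := by simp [γ]
  have hγ : HasDerivAt γ (fderiv ℝ v z (Pi.single i 1), 0, 0) 0 := by
    have hline :
        HasDerivAt (fun s : ℝ => z + s • (Pi.single i 1 : Fin dz → ℝ)) (Pi.single i 1) 0 := by
      simpa using ((hasDerivAt_id (0 : ℝ)).smul_const (Pi.single i 1 : Fin dz → ℝ)).const_add z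
    have hvz : HasFDerivAt v (fderiv ℝ v z) (z + (0 : ℝ) • (Pi.single i 1 : Fin dz → ℝ)) := by
      rw [hz0]
      exact (hv.2.1.differentiable one_ne_zero z).hasFDerivAt
    exact (hvz.comp_hasDerivAt (0 : ℝ) hline).prodMk (hasDerivAt_const (0 : ℝ)
      (((fun s => v (zh s)), ah) :
        (Fin (t : ℕ) → Fin dz → ℝ) × (Fin ((t : ℕ) + 1) → Fin da → ℝ)))
  rw [← hγ0]
  refine fderiv_fderiv_eq_zero_of_separated (γ := γ) ?_ hγ ?_
  · rw [hγ0]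
    exact hci.contDiffAt_logDensity hs t hahA hposθ
  -- positivity for small displacements
  have hpos_s : ∀ᶠ s in 𝓝 (0 : ℝ), 0 < θ'.p t (z + s • Pi.single i 1) zh ah := by
    have hc : Tendsto (fun s : ℝ => (z + s • (Pi.single i 1 : Fin dz → ℝ), zh, ah)) (𝓝 0)
        (𝓝[domain dz A t] (z, zh, ah)) := by
      refine tendsto_nhdsWithin_iff.mpr ⟨?_, Eventually.of_forall fun s =>
        ⟨Set.mem_univ _, Set.mem_univ _, hahA⟩⟩
      have hcont : Continuous fun s : ℝ => (z + s • (Pi.single i 1 : Fin dz → ℝ), zh, ah) := by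
        fun_prop
      simpa using hcont.tendsto 0
    exact hc.eventually (hci'.eventually_pos hs' t hahA hpos)
  have hmem_u : ∀ᶠ u in 𝓝 (0 : ℝ), ah + u • e ∈ seqs (interior A) ((t : ℕ) + 1) := by
    have hcont : Continuous fun u : ℝ => ah + u • e := by fun_prop
    exact hcont.continuousAt.eventually (by simpa using hopen.mem_nhds hah)
  have hpos_u : ∀ᶠ u in 𝓝 (0 : ℝ), 0 < θ'.p t z zh (ah + u • e) := by
    have hc : Tendsto (fun u : ℝ => (z, zh, ah + u • e)) (𝓝 0)
        (𝓝[domain dz A t] (z, zh, ah)) := by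
      refine tendsto_nhdsWithin_iff.mpr ⟨?_, hmem_u.mono fun u hu =>
        ⟨Set.mem_univ _, Set.mem_univ _, hsub hu⟩⟩
      have hcont : Continuous fun u : ℝ => (z, zh, ah + u • e) := by fun_prop
      simpa using hcont.tendsto 0
    exact hc.eventually (hci'.eventually_pos hs' t hahA hpos)
  -- the factor depending on the latent displacement, and the one depending on the other variable
  let M : ℝ → ℝ := fun s => θ'.mech t i (z i + s) zh ah
  let R : ℝ → ℝ := fun u => ∏ k ∈ Finset.univ.erase i, θ'.mech t k (z k) zh (ah + u • e)
  have hMR : ∀ s u, ah + u • e ∈ seqs A ((t : ℕ) + 1) →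
      θ'.p t (z + s • Pi.single i 1) zh (ah + u • e) = M s * R u := fun s u hu =>
    hgraph'.p_add_single hci' τ hahA hil s u hu
  have hM : ∀ s, 0 < θ'.p t (z + s • Pi.single i 1) zh ah → M s ≠ 0 := by
    intro s h hM0
    have h1 := hMR s 0 (by rwa [hah0])
    rw [hah0, hM0, zero_mul] at h1
    exact h.ne' h1
  have hR : ∀ u, ah + u • e ∈ seqs A ((t : ℕ) + 1) → 0 < θ'.p t z zh (ah + u • e) → R u ≠ 0 := by
    intro u hu h hR0
    have h1 := hMR 0 u hu
    rw [hz0, hR0, mul_zero] at h1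
    exact h.ne' h1
  have hF : ∀ s u, ah + u • e ∈ seqs A ((t : ℕ) + 1) → M s ≠ 0 → R u ≠ 0 →
      θ.logDensity A t (γ s + u • (0, 0, e)) =
        Real.log (M s) + Real.log (R u) -
          Real.log |(fderiv ℝ v (z + s • Pi.single i 1)).det| := by
    intro s u hu hMs hRu
    have hγs : γ s + u • ((0, 0, e) : (Fin dz → ℝ) × (Fin (t : ℕ) → Fin dz → ℝ) ×
        (Fin ((t : ℕ) + 1) → Fin da → ℝ)) =
        (v (z + s • Pi.single i 1), fun s => v (zh s), ah + u • e) := by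
      simp [γ]
    have h1 := hp t _ hu zh (z + s • Pi.single i 1)
    rw [hMR s u hu] at h1
    rw [hγs, hci.logDensity_eq hs t _ _ hu, ← Real.log_mul hMs hRu,
      ← Real.log_div (mul_ne_zero hMs hRu) (hdet _).ne', h1, mul_div_cancel_right₀ _ (hdet _).ne']
  filter_upwards [hpos_s] with s hs1
  refine ⟨Real.log (M s) - Real.log |(fderiv ℝ v (z + s • Pi.single i 1)).det| -
    (Real.log (M 0) - Real.log |(fderiv ℝ v (z + (0 : ℝ) • Pi.single i 1)).det|), ?_⟩
  filter_upwards [hmem_u, hpos_u] with u hu1 hu2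
  have hRu := hR u (hsub hu1) hu2
  rw [hF s u (hsub hu1) (hM s hs1) hRu, hF 0 u (hsub hu1) (hM 0 (by rwa [hz0])) hRu]
  ring

/-- The same at all histories in `𝒜ᵗ`: the second derivative of the log-density is continuous, and
`𝒜` is the closure of its interior. -/
lemma DiffEquiv.mixed_derivative_eq_zero (hd : DiffEquiv A θ θ')
    (hci : θ.CondIndep A) (hci' : θ'.CondIndep A)
    (hs : θ.SmoothTransition A) (hs' : θ'.SmoothTransition A) (hgraph' : θ'.MarkovGraph A)
    {t : Fin T} (τ : Fin ((t : ℕ) + 1)) {z : Fin dz → ℝ} {zh : Fin (t : ℕ) → Fin dz → ℝ}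
    {ah : Fin ((t : ℕ) + 1) → Fin da → ℝ} (hah : ah ∈ seqs A ((t : ℕ) + 1))
    (hpos : 0 < θ'.p t z zh ah) {i : Fin dz} {l : Fin da} (hil : θ'.Ga i l = false) :
    fderiv ℝ (fderiv ℝ (θ.logDensity A t))
      (entanglement θ θ' z, fun s => entanglement θ θ' (zh s), ah)
      (0, 0, Pi.single τ (Pi.single l 1))
      (fderiv ℝ (entanglement θ θ') z (Pi.single i 1), 0, 0) = 0 := by
  have hposθ : 0 < θ.p t (entanglement θ θ' z) (fun s => entanglement θ θ' (zh s)) ah :=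
    pos_of_mul_pos_left ((hd.2.2 t ah hah zh z) ▸ hpos) (abs_nonneg _)
  have hsub : seqs (interior A) ((t : ℕ) + 1) ⊆ seqs A ((t : ℕ) + 1) :=
    fun _ h s => interior_subset (h s)
  have hcl : ah ∈ closure (seqs (interior A) ((t : ℕ) + 1)) := by
    rw [seqs_eq_pi, closure_pi_set]
    simp_rw [hs.1]
    rwa [← seqs_eq_pi]
  have hne := mem_closure_iff_nhdsWithin_neBot.mp hcl
  have hF := hci.contDiffAt_logDensity hs t hah hposθ
  have hF2 : ContinuousAt (fderiv ℝ (fderiv ℝ (θ.logDensity A t)))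
      (entanglement θ θ' z, fun s => entanglement θ θ' (zh s), ah) :=
    ((hF.fderiv_right (m := 1) (by norm_num)).fderiv_right (m := 0) (by norm_num)).continuousAt
  have hcont : ContinuousAt (fun ah => fderiv ℝ (fderiv ℝ (θ.logDensity A t))
      (entanglement θ θ' z, fun s => entanglement θ θ' (zh s), ah)
      (0, 0, Pi.single τ (Pi.single l 1))
      (fderiv ℝ (entanglement θ θ') z (Pi.single i 1), 0, 0)) ah := by
    have hin : ContinuousAt (fun ah : Fin ((t : ℕ) + 1) → Fin da → ℝ =>
        (entanglement θ θ' z, (fun s => entanglement θ θ' (zh s)), ah)) ah := by fun_prop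
    have h1 := ContinuousAt.comp (f := fun ah : Fin ((t : ℕ) + 1) → Fin da → ℝ =>
        (entanglement θ θ' z, (fun s => entanglement θ θ' (zh s)), ah)) hF2 hin
    exact (h1.clm_apply continuousAt_const).clm_apply continuousAt_const
  have hev : ∀ᶠ ah' in 𝓝[seqs (interior A) ((t : ℕ) + 1)] ah, 0 < θ'.p t z zh ah' := by
    have hc : Tendsto (fun ah' => (z, zh, ah')) (𝓝[seqs (interior A) ((t : ℕ) + 1)] ah)
        (𝓝[domain dz A t] (z, zh, ah)) := by
      refine tendsto_nhdsWithin_iff.mpr ⟨?_, eventually_mem_nhdsWithin.mono fun ah' h =>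
        ⟨Set.mem_univ _, Set.mem_univ _, hsub h⟩⟩
      have hc : Continuous fun ah' : Fin ((t : ℕ) + 1) → Fin da → ℝ => (z, zh, ah') := by fun_prop
      exact (hc.tendsto ah).mono_left nhdsWithin_le_nhds
    exact hc.eventually (hci'.eventually_pos hs' t hah hpos)
  refine tendsto_nhds_unique (l := 𝓝[seqs (interior A) ((t : ℕ) + 1)] ah)
    (hcont.tendsto.mono_left nhdsWithin_le_nhds)
    (tendsto_const_nhds.congr' ?_)
  filter_upwards [hev, eventually_mem_nhdsWithin] with ah' h1 h2
  exact (hd.mixed_derivative_eq_zero_of_interior hci hci' hs hs' hgraph' τ h2 h1 hil).symm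

/-- The mixed derivative along `a_l` and a latent direction `d` is the pairing of `d` with the
column `l` of the cross Hessian. -/
lemma CondIndep.mixed_derivative_eq_sum (hci : θ.CondIndep A) (hs : θ.SmoothTransition A)
    {t : Fin T} (τ : Fin ((t : ℕ) + 1)) {z : Fin dz → ℝ} {zh : Fin (t : ℕ) → Fin dz → ℝ}
    {ah : Fin ((t : ℕ) + 1) → Fin da → ℝ} (hah : ah ∈ seqs A ((t : ℕ) + 1))
    (hpos : 0 < θ.p t z zh ah) (l : Fin da) (d : Fin dz → ℝ) :
    fderiv ℝ (fderiv ℝ (θ.logDensity A t)) (z, zh, ah) (0, 0, Pi.single τ (Pi.single l 1))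
      (d, 0, 0) = ∑ j, d j * θ.crossHessian A t τ z zh ah j l := by
  have hF := hci.contDiffAt_logDensity hs t hah hpos
  simp_rw [crossHessian, Matrix.of_apply, fderiv_fderiv_apply hF]
  set D := fderiv ℝ (fderiv ℝ (θ.logDensity A t)) (z, zh, ah) (0, 0, Pi.single τ (Pi.single l 1))
  have h := LinearMap.pi_apply_eq_sum_univ
    ((D : _ →ₗ[ℝ] ℝ) ∘ₗ LinearMap.inl ℝ (Fin dz → ℝ)
      ((Fin (t : ℕ) → Fin dz → ℝ) × (Fin ((t : ℕ) + 1) → Fin da → ℝ))) d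
  simp only [LinearMap.comp_apply, LinearMap.inl_apply, smul_eq_mul] at h
  refine h.trans (Finset.sum_congr rfl fun j _ => ?_)
  have : (fun i => if j = i then (1 : ℝ) else 0) = Pi.single j 1 := by
    ext i
    simp [Pi.single_apply, eq_comm]
  rw [this]
  rfl

/-- The Jacobian of the entanglement map vanishes at `(j, i)` whenever some `a_l` acts on the
factor `j` of the first model, but not on the factor `i` of the second one. -/
theorem DiffEquiv.fderiv_entanglement_eq_zero (hd : DiffEquiv A θ θ')
    (hci : θ.CondIndep A) (hci' : θ'.CondIndep A)
    (hs : θ.SmoothTransition A) (hs' : θ'.SmoothTransition A) (hgraph' : θ'.MarkovGraph A)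
    (hinf : θ.SufficientInfluence A) {i j : Fin dz} {l : Fin da} (hjl : θ.Ga j l = true)
    (hil : θ'.Ga i l = false) (z : Fin dz → ℝ) :
    fderiv ℝ (entanglement θ θ') z (Pi.single i 1) j = 0 := by
  have hv := hd.2.1
  set v := entanglement θ θ' with hvdef
  have hnull : ∀ᵐ z : Fin dz → ℝ, fderiv ℝ v z (Pi.single i 1) j = 0 := by
    have hpre : ∀ᵐ z : Fin dz → ℝ, ∃ γ : Fin (children θ.Ga l).card → HistoryPoint T dz da,
        (∀ r, (γ r).ah ∈ seqs A (((γ r).t : ℕ) + 1)) ∧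
        (∀ r, 0 < θ.p (γ r).t (v z) (γ r).zh (γ r).ah) ∧
        Submodule.span ℝ (Set.range fun r => fun i =>
          θ.crossHessian A (γ r).t (γ r).τ (v z) (γ r).zh (γ r).ah i l) =
          alignedVectors (children θ.Ga l) := by
      -- the inverse of `v` is `C¹`, hence maps null sets to null sets
      have h0 := addHaar_image_eq_zero_of_differentiableOn_of_addHaar_eq_zero volume
        (hv.2.2.differentiable one_ne_zero).differentiableOn (ae_iff.mp hinf)
      refine measure_mono_null ?_ h0
      intro z hz
      exact ⟨v z, fun h => hz (h l), leftInverse_invFun hv.1.1 z⟩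
    filter_upwards [hpre] with z ⟨γ, hγA, hγpos, hspan⟩
    let φ : (Fin dz → ℝ) →ₗ[ℝ] ℝ :=
      ∑ k, (fderiv ℝ v z (Pi.single i 1) k) • LinearMap.proj k
    have hφ : ∀ x, φ x = ∑ k, fderiv ℝ v z (Pi.single i 1) k * x k := by
      intro x
      simp [φ]
    have hker : alignedVectors (children θ.Ga l) ≤ LinearMap.ker φ := by
      rw [← hspan, Submodule.span_le]
      rintro _ ⟨r, rfl⟩
      have hzh : (fun s => v (invFun v ((γ r).zh s))) = (γ r).zh :=
        funext fun s => hv.apply_invFun _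
      have hpos' : 0 < θ'.p (γ r).t z (fun s => invFun v ((γ r).zh s)) (γ r).ah := by
        rw [hd.2.2 _ _ (hγA r)]
        refine mul_pos ?_ (abs_pos.mpr (hv.det_fderiv_ne_zero z))
        rw [← hvdef, hzh]
        exact hγpos r
      have h := hd.mixed_derivative_eq_zero hci hci' hs hs' hgraph' (γ r).τ (hγA r) hpos' hil
      rw [← hvdef, hzh, hci.mixed_derivative_eq_sum hs _ (hγA r) (hγpos r)] at h
      simpa [hφ] using h
    have hmem : (Pi.single j 1 : Fin dz → ℝ) ∈ alignedVectors (children θ.Ga l) := by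
      intro k hk
      refine Pi.single_eq_of_ne ?_ _
      rintro rfl
      exact hk (by simp [children, hjl])
    have h := hker hmem
    rw [LinearMap.mem_ker, hφ] at h
    simpa [Pi.single_apply] using h
  have hcont : Continuous fun z => fderiv ℝ v z (Pi.single i 1) j :=
    (continuous_apply j).comp ((hv.2.1.continuous_fderiv one_ne_zero).clm_apply continuous_const)
  exact congrFun ((hcont.ae_eq_iff_eq volume continuous_const).mp hnull) z

end LatentModel

/-! ### Permutations and dependency graphs -/

/-- An invertible matrix has a permutation along which no entry vanishes. -/
lemma exists_perm_forall_apply_ne_zero {m : ℕ} {L : (Fin m → ℝ) →L[ℝ] (Fin m → ℝ)}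
    (hL : L.det ≠ 0) : ∃ π : Equiv.Perm (Fin m), ∀ i, L (Pi.single i 1) (π i) ≠ 0 := by
  rw [ContinuousLinearMap.det, ← LinearMap.det_toMatrix', Matrix.det_apply] at hL
  obtain ⟨π, -, hπ⟩ := Finset.exists_ne_zero_of_sum_ne_zero hL
  refine ⟨π, fun i => ?_⟩
  have h1 : ∏ i, LinearMap.toMatrix' (L : (Fin m → ℝ) →ₗ[ℝ] (Fin m → ℝ)) (π i) i ≠ 0 := by
    intro h0
    rw [h0, smul_zero] at hπ
    exact hπ rfl
  have h2 := Finset.prod_ne_zero_iff.mp h1 i (Finset.mem_univ i)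
  simpa [LinearMap.toMatrix'_apply, Pi.single_apply] using h2

lemma permMatrix_mul_adj_apply {m n : ℕ} (π : Equiv.Perm (Fin m)) (G : Matrix (Fin m) (Fin n) Bool)
    (i : Fin m) (l : Fin n) : (π.permMatrix ℝ * adj G) i l = adj G (π i) l := by
  rw [Equiv.Perm.permMatrix, PEquiv.toMatrix_toPEquiv_mul]
  rfl

lemma adj_ne_zero_iff {m n : ℕ} (G : Matrix (Fin m) (Fin n) Bool) (i : Fin m) (l : Fin n) :
    adj G i l ≠ 0 ↔ G i l = true := by
  simp [adj]

/-- An inclusion of graphs up to a permutation of the rows is an equality if the larger graph has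
no more edges than the smaller one. -/
lemma eq_of_perm_le_of_nnz_le {m n : ℕ} {G G' : Matrix (Fin m) (Fin n) Bool}
    {π : Equiv.Perm (Fin m)} (hle : ∀ i l, G (π i) l = true → G' i l = true)
    (hnnz : nnz G' ≤ nnz G) (i : Fin m) (l : Fin n) : G' i l = G (π i) l := by
  let S := Finset.univ.filter fun x : Fin m × Fin n => G (π x.1) x.2 = true
  let S' := Finset.univ.filter fun x : Fin m × Fin n => G' x.1 x.2 = true
  have hsub : S ⊆ S' := by
    intro x hx
    simp only [S, S', Finset.mem_filter, Finset.mem_univ, true_and] at hx ⊢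
    exact hle _ _ hx
  have hcard : nnz G = S.card := by
    refine (Finset.card_equiv (π.prodCongr (Equiv.refl _)) fun x => ?_).symm
    simp [S]
  have hS : S = S' := Finset.eq_of_subset_of_card_le hsub (by rw [← hcard]; exact hnnz)
  have h := Finset.ext_iff.mp hS (i, l)
  simp only [S, S', Finset.mem_filter, Finset.mem_univ, true_and] at h
  exact Bool.eq_iff_iff.mpr h.symm

/-- A component with a vanishing partial derivative does not depend on that coordinate. -/
lemma apply_update_eq_of_fderiv_eq_zero {m : ℕ} {v : (Fin m → ℝ) → (Fin m → ℝ)}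
    (hv : Differentiable ℝ v) {i j : Fin m} (h : ∀ z, fderiv ℝ v z (Pi.single i 1) j = 0)
    (z : Fin m → ℝ) (s : ℝ) : v (update z i s) j = v z j := by
  have hder : ∀ s, HasDerivAt (fun s => v (update z i s) j) 0 s := by
    intro s
    have h1 := (hv (update z i s)).hasFDerivAt.comp_hasDerivAt s (hasDerivAt_update z i s)
    have h2 := hasDerivAt_pi.mp h1 j
    rwa [h] at h2
  have h3 := is_const_of_deriv_eq_zero (fun s => (hder s).differentiableAt)
    (fun s => (hder s).deriv) s (z i)
  simpa using h3

lemma depGraph_eq_false {m n : ℕ} {c : (Fin n → ℝ) → (Fin m → ℝ)} {j : Fin m} {k : Fin n}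
    (h : ∀ y s, c (update y k s) j = c y j) : depGraph c j k = false := by
  simp only [depGraph, Matrix.of_apply, decide_eq_false_iff_not, not_not]
  refine ⟨fun y => c (fun k' => if hk : k' ≠ k then y ⟨k', hk⟩ else 0) j, fun a => ?_⟩
  rw [← h a 0]
  refine congrFun (congrArg c (funext fun k' => ?_)) j
  by_cases hk : k' = k
  · subst hk
    simp
  · simp [hk]

/-- It suffices for a map to be `G`-preserving that its `j`-th component does not depend on the
coordinate `k` whenever the row `j` of `G` is not contained in the row `k`. -/
lemma preservingMap_of_forall {m n : ℕ} {G : Matrix (Fin m) (Fin n) Bool}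
    {c : (Fin m → ℝ) → (Fin m → ℝ)}
    (h : ∀ j k l, G j l = true → G k l = false → depGraph c j k = false) : PreservingMap G c := by
  intro M hM k l hkl
  rw [Matrix.mul_apply]
  refine Finset.sum_eq_zero fun j _ => ?_
  cases hj : G j l with
  | false => rw [hM j l hj, mul_zero]
  | true => simp [adj, h j k l hj hkl]

lemma IsDiffeo.comp_perm {m : ℕ} {v : (Fin m → ℝ) → (Fin m → ℝ)} (hv : IsDiffeo v)
    (π : Equiv.Perm (Fin m)) : IsDiffeo fun y => v fun i => y (π i) := by
  refine isDiffeo_of_inverse (w := fun z k => invFun v z (π.symm k)) ?_ ?_ ?_ ?_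
  · exact hv.2.1.comp (contDiff_pi.mpr fun i => contDiff_apply ℝ ℝ (π i))
  · exact contDiff_pi.mpr fun k => contDiff_pi.mp hv.2.2 (π.symm k)
  · intro y
    funext k
    simp [leftInverse_invFun hv.1.1 _]
  · intro z
    simp [hv.apply_invFun]

end Disentangle

open Disentangle in
theorem mainTheorem1 {T dz dx da : ℕ} (hT : 0 < T) (σ2 : ℝ≥0)
    (A : Set (Fin da → ℝ)) (hA : A.Nonempty)
    (θ θ' : LatentModel T dz dx da)
    (hobs : θ.ObservationModel) (hobs' : θ'.ObservationModel)
    (hci : θ.CondIndep A) (hci' : θ'.CondIndep A)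
    (hgraph : θ.MarkovGraph A) (hgraph' : θ'.MarkovGraph A)
    (hsmooth : θ.SmoothTransition A) (hsmooth' : θ'.SmoothTransition A)
    (hequiv : LatentModel.ObsEquiv σ2 A θ θ')
    (hinf : θ.SufficientInfluence A) :
    (∃ π : Equiv.Perm (Fin dz), SuppSubset (π.permMatrix ℝ * adj θ.Ga) (adj θ'.Ga)) ∧
    (nnz θ'.Ga ≤ nnz θ.Ga → LatentModel.AConsistent A θ θ') := by
  have hd := hequiv.diffEquiv hT hA hobs hobs' hci hci' hsmooth hsmooth'
  have hv := hd.2.1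
  have hJ : ∀ {i j : Fin dz} {l : Fin da}, θ.Ga j l = true → θ'.Ga i l = false → ∀ z,
      fderiv ℝ (LatentModel.entanglement θ θ') z (Pi.single i 1) j = 0 := fun hjl hil =>
    hd.fderiv_entanglement_eq_zero hci hci' hsmooth hsmooth' hgraph' hinf hjl hil
  obtain ⟨π, hπ⟩ := exists_perm_forall_apply_ne_zero (hv.det_fderiv_ne_zero 0)
  have hle : ∀ i l, θ.Ga (π i) l = true → θ'.Ga i l = true := by
    intro i l h
    by_contra hil
    exact hπ i (hJ h (Bool.eq_false_iff.mpr hil) 0)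
  refine ⟨⟨π, fun i l h => ?_⟩, fun hnnz => ?_⟩
  · rw [permMatrix_mul_adj_apply, adj_ne_zero_iff] at h
    exact (adj_ne_zero_iff _ _ _).mpr (hle i l h)
  have heq := eq_of_perm_le_of_nnz_le hle hnnz
  refine ⟨π, hd, ?_, fun y => LatentModel.entanglement θ θ' fun i => y (π i), hv.comp_perm π,
    preservingMap_of_forall fun j k l hj hk => depGraph_eq_false fun y s => ?_, fun z => ?_⟩
  · ext i l
    rw [permMatrix_mul_adj_apply]
    simp [adj, heq]
  · have hupd : (fun i => Function.update y k s (π i)) =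
        Function.update (fun i => y (π i)) (π.symm k) s := Function.update_comp_equiv y π k s
    simp only [hupd]
    refine apply_update_eq_of_fderiv_eq_zero (hv.2.1.differentiable one_ne_zero) (hJ hj ?_) _ _
    rw [heq, Equiv.apply_symm_apply, hk]
  · have ht : (π.permMatrix ℝ)ᵀ *ᵥ z = fun k => z (π.symm k) := by
      rw [Matrix.mulVec_transpose, Matrix.vecMul_permMatrix]
      rfl
    simp only [ht, Equiv.symm_apply_apply]
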